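/- Conventions. A partition is proper if it has no part equal to $1$; $|\lambda|$ is the sum of the parts of $\lambda$. Let $[2n]=\{1,\dots,2n\}$ be divided into the $n$ pairs $\{2k-1,2k\}$. A partial bijection of $n$ is a bijection $\sigma:d\to d'$ where $d,d'\subseteq[2n]$ are (possibly empty) unions of pairs; permutations in $\mathcal S_{2n}$ are the case $d=d'=[2n]$. Its coset-type $ct(\sigma)$ is the partition of $|d|/2$ formed by the half-lengths of the cycles of the graph $\Gamma(\sigma)$ with vertex set $d$ in which $x,y$ are joined by an (exterior) edge if $\{x,y\}$ is a pair, and by an (interior) edge if $\{\sigma(x),\sigma(y)\}$ is a pair. For a proper partition $\lambda$ with $|\lambda|\le n$ let $K_\lambda(n)\in\mathbb C[\mathcal S_{2n}]$ be the sum of all permutations of coset-type $\lambda\cup(1^{n-|\lambda|})$. For proper $\lambda,\delta$ with $|\lambda|,|\delta|\le n$ the structure coefficients $\alpha_{\lambda\delta}^{\rho}(n)$ are defined by $$K_\lambda(n)\cdot K_\delta(n)=\sum_{\rho\text{ proper},\ |\rho|\le n}\alpha_{\lambda\delta}^{\rho}(n)\,K_\rho(n).$$ A partial bijection $\tilde\sigma:\tilde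 d\to\tilde d'$ of $n$ is a trivial extension of $\sigma:d\to d'$ if $d\subseteq\tilde d$, $\tilde\sigma|_d=\sigma$ and $ct(\tilde\sigma)=ct(\sigma)\cup(1^{|\tilde d\setminus d|/2})$. On the vector space $\mathcal D_n$ with basis the partial bijections of $n$, let $\ast$ be the bilinear product for which $\alpha_1\ast\alpha_2$ (where $\alpha_i$ has domain $d_i$ and codomain $d_i'$) is the average of $\tilde\alpha_1\circ\tilde\alpha_2$ over all pairs $(\tilde\alpha_1,\tilde\alpha_2)$ of trivial extensions of $\alpha_1,\alpha_2$ such that the domain of $\tilde\alpha_1$ and the codomain of $\tilde\alpha_2$ both equal $d_1\cup d_2'$. For a partition $\lambda$ let $S_{\lambda,n}\in\mathcal D_n$ be the sum of all partial bijections of $n$ of coset-type $\lambda$, let $T_\lambda$ be the sequence whose $n$-th term ($n\ge1$) is $\binom{n}{|\lambda|}^{-1}S_{\lambda,n}$ if $n\ge|\lambda|$ and $0$ otherwise, and multiply such sequences term by term. The numbers $c_{\lambda\delta}^\rho(n)$ (for $|\lambda|,|\delta|\le n$) and $b_{\lambda\delta}^\rho$ are defined by $$S_{\lambda,n}\ast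 S_{\delta,n}=\sum_{|\rho|\le n}c_{\lambda\delta}^{\rho}(n)\,S_{\rho,n},\qquad T_\lambda\ast T_\delta=\sum_{\rho}b_{\lambda\delta}^{\rho}\,T_\rho,$$ the sums being over partitions $\rho$ (in the second one, an equality of sequences, only finitely many terms are nonzero in each degree $n$). Statement. Let $\lambda,\delta,\rho$ be proper partitions with $|\rho|=|\lambda|+|\delta|$. Then the coefficients $\alpha_{\lambda\delta}^{\cdot}(n)$ ($n\ge|\rho|$), $c_{\lambda\delta}^{\cdot}(|\rho|)$ and $b_{\lambda\delta}^{\cdot}$ exist, the family $b_{\lambda\delta}^{\cdot}$ is unique, and for every $n\ge|\rho|$ $$\alpha_{\lambda\delta}^{\rho}(n)=b_{\lambda\delta}^{\rho}\,\frac{|\rho|!}{|\lambda|!\,|\delta|!}\,2^n n!=c_{\lambda\delta}^{\rho}(|\rho|)\,\frac{|\lambda|!\,|\delta|!}{(|\lambda|+|\delta|)!}\,2^n n!.$$ In particular, a polynomial $f$ satisfies $\alpha_{\lambda\delta}^{\rho}(n)=2^n n!\,f(n)$ for all $n\ge|\rho|$ if and only if $f$ is the constant $b_{\lambda\delta}^{\rho}\frac{|\rho|!}{|\lambda|!\,|\delta|!}$.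 -/

import Mathlib

namespace HeckeS2n

/-- The ground set `[2n]`, written as `n` pairs: `(k, false)` and `(k, true)` are the two elements
`2k - 1` and `2k` of the `k`-th pair. -/
abbrev Pt (n : ℕ) : Type := Fin n × Bool

/-- A partition is proper if it has no part equal to `1`. -/
def IsProper {k : ℕ} (p : k.Partition) : Prop := 1 ∉ p.parts

/-- The graph `Γ(σ)` of a partial injection `σ` of `[2n]`: its vertices are the elements of the
domain; `x`, `y` are joined by an exterior edge if they form a pair, and by an interior edge
if `σ x`, `σ y` form a pair. (When both edges are present they form a cycle of length `2`.) -/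
def cosetGraph {n : ℕ} (σ : Pt n ≃. Pt n) : SimpleGraph {x : Pt n // (σ x).isSome} where
  Adj x y := x ≠ y ∧ (x.1.1 = y.1.1 ∨ ((σ x.1).get x.2).1 = ((σ y.1).get y.2).1)
  symm := ⟨fun _ _ h => ⟨h.1.symm, h.2.imp Eq.symm Eq.symm⟩⟩
  loopless := ⟨fun _ h => h.1 rfl⟩

open Classical in
/-- The coset-type: the multiset of half-lengths of the cycles, i.e. of the connected components,
of `Γ(σ)`. -/
noncomputable def cosetType {n : ℕ} (σ : Pt n ≃. Pt n) : Multiset ℕ :=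
  (Finset.univ : Finset (cosetGraph σ).ConnectedComponent).val.map
    fun C => Nat.card C.supp / 2

/-! ### The Hecke algebra side -/

open Classical in
/-- `K_p(n)`: the sum, in the group algebra of the symmetric group of `[2n]`, of all permutations
of coset-type `p ∪ (1^{n - |p|})`. -/
noncomputable def K (n : ℕ) {k : ℕ} (p : k.Partition) : MonoidAlgebra ℂ (Equiv.Perm (Pt n)) :=
  ∑ ω : Equiv.Perm (Pt n) with
    cosetType ω.toPEquiv = p.parts + Multiset.replicate (n - k) 1, MonoidAlgebra.single ω 1

open Classical in
/-- `a` gives the structure coefficients of `K_lam(n) · K_del(n)` in the basis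
`K_p(n)`, `p` a proper partition of size at most `n`. -/
def IsHeckeExpansion (n : ℕ) {l d : ℕ} (lam : l.Partition) (del : d.Partition)
    (a : (k : ℕ) → k.Partition → ℂ) : Prop :=
  K n lam * K n del =
    ∑ k ∈ Finset.range (n + 1), ∑ p : k.Partition with IsProper p, a k p • K n p

/-! ### Partial bijections -/

/-- A partial bijection of `n`: a bijection between two unions of pairs of `[2n]`. -/
structure PartialBij (n : ℕ) where
  map : Pt n ≃. Pt n
  dom_pairs : ∀ i, (map (i, false)).isSome = (map (i, true)).isSome
  cod_pairs : ∀ i, (map.symm (i, false)).isSome = (map.symm (i, true)).isSome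

namespace PartialBij

variable {n : ℕ}

theorem map_injective : Function.Injective (PartialBij.map : PartialBij n → (Pt n ≃. Pt n)) := by
  rintro ⟨f, _, _⟩ ⟨g, _, _⟩ h
  cases h
  rfl

instance : Finite (PartialBij n) :=
  Finite.of_injective (fun a : PartialBij n => (a.map : Pt n → Option (Pt n)))
    fun _ _ h => map_injective (DFunLike.coe_injective h)

noncomputable instance : Fintype (PartialBij n) := Fintype.ofFinite _

noncomputable instance : DecidableEq (PartialBij n) := Classical.decEq _

/-- The indices of the pairs whose union is the domain. -/
def dom (a : PartialBij n) : Finset (Fin n) := {i | (a.map (i, false)).isSome}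

/-- The indices of the pairs whose union is the codomain. -/
def cod (a : PartialBij n) : Finset (Fin n) := {i | (a.map.symm (i, false)).isSome}

theorem isSome_map_iff (a : PartialBij n) (x : Pt n) : (a.map x).isSome ↔ x.1 ∈ a.dom := by
  obtain ⟨i, b⟩ := x
  have := a.dom_pairs i
  cases b <;> simp_all [dom]

theorem isSome_symm_iff (a : PartialBij n) (x : Pt n) :
    (a.map.symm x).isSome ↔ x.1 ∈ a.cod := by
  obtain ⟨i, b⟩ := x
  have := a.cod_pairs i
  cases b <;> simp_all [cod]

theorem isSome_trans {α β γ : Type*} (f : α ≃. β) (g : β ≃. γ)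
    (h : ∀ y, (f.symm y).isSome → (g y).isSome) (x : α) :
    ((f.trans g) x).isSome = (f x).isSome := by
  rw [Bool.eq_iff_iff]
  constructor
  · intro hx
    obtain ⟨z, hz⟩ := Option.isSome_iff_exists.1 hx
    obtain ⟨y, hy, _⟩ := (PEquiv.mem_trans f g x z).1 hz
    exact Option.isSome_iff_exists.2 ⟨y, hy⟩
  · intro hx
    obtain ⟨y, hy⟩ := Option.isSome_iff_exists.1 hx
    have hy' : x ∈ f.symm y := (PEquiv.mem_iff_mem f).2 hy
    obtain ⟨z, hz⟩ := Option.isSome_iff_exists.1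
      (h y (Option.isSome_iff_exists.2 ⟨x, hy'⟩))
    exact Option.isSome_iff_exists.2 ⟨z, (PEquiv.mem_trans f g x z).2 ⟨y, hy, hz⟩⟩

/-- The composition `a ∘ b` (first `b`, then `a`) when the domain of `a` is the codomain of `b`. -/
def comp (a b : PartialBij n) (h : a.dom = b.cod) : PartialBij n where
  map := b.map.trans a.map
  dom_pairs i := by
    have key := isSome_trans b.map a.map fun y hy => by
      rw [isSome_map_iff, h, ← isSome_symm_iff]; exact hy
    rw [key, key, b.dom_pairs]
  cod_pairs i := by
    have key := isSome_trans a.map.symm b.map.symm fun y hy => by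
      rw [PEquiv.symm_symm] at hy
      rw [isSome_symm_iff, ← h, ← isSome_map_iff]; exact hy
    rw [PEquiv.symm_trans_rev, key, key, a.cod_pairs]

/-- `a'` is a trivial extension of `a`: it extends `a` as a map, and its coset-type is that of `a`
with parts `1` added. -/
def IsTrivialExtension (a a' : PartialBij n) : Prop :=
  a.map ≤ a'.map ∧
    cosetType a'.map = cosetType a.map + Multiset.replicate (a'.dom \ a.dom).card 1

open Classical in
/-- The set `E_{a₁}^{a₂}(n)` of pairs of trivial extensions of `a₁`, `a₂` whose domain,
respectively codomain, is the union of the domain of `a₁` and the codomain of `a₂`. -/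
noncomputable def E (a₁ a₂ : PartialBij n) : Finset (PartialBij n × PartialBij n) :=
  {p | IsTrivialExtension a₁ p.1 ∧ IsTrivialExtension a₂ p.2 ∧
    p.1.dom = a₁.dom ∪ a₂.cod ∧ p.2.cod = a₁.dom ∪ a₂.cod}

theorem dom_eq_cod_of_mem_E {a₁ a₂ : PartialBij n} {p : PartialBij n × PartialBij n}
    (h : p ∈ E a₁ a₂) : p.1.dom = p.2.cod := by
  simp only [E, Finset.mem_filter, Finset.mem_univ, true_and] at h
  exact h.2.2.1.trans h.2.2.2.symm

end PartialBij

/-- The vector space with basis the partial bijections of `n`. Its product is `D.mul` below. -/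
abbrev D (n : ℕ) : Type := PartialBij n →₀ ℂ

namespace D

/-- The product of two partial bijections: the average of the compositions of the pairs
in `E_{a₁}^{a₂}(n)`. -/
noncomputable def basisMul {n : ℕ} (a₁ a₂ : PartialBij n) : D n :=
  ((PartialBij.E a₁ a₂).card : ℂ)⁻¹ • ∑ p ∈ (PartialBij.E a₁ a₂).attach,
    Finsupp.single (p.1.1.comp p.1.2 (PartialBij.dom_eq_cod_of_mem_E p.2)) 1

/-- The bilinear extension of `basisMul`. -/
noncomputable def mul {n : ℕ} (x y : D n) : D n :=
  x.sum fun a₁ r => y.sum fun a₂ s => (r * s) • basisMul a₁ a₂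

end D

open Classical in
/-- `S_{p,n}`: the sum of all partial bijections of `n` of coset-type `p`. -/
noncomputable def S (n : ℕ) {k : ℕ} (p : k.Partition) : D n :=
  ∑ a : PartialBij n with cosetType a.map = p.parts, Finsupp.single a 1

/-- `c` gives the structure coefficients of `S_{lam,n} ∗ S_{del,n}` in the basis
`S_{p,n}`, `p` a partition of size at most `n`. -/
def IsPartialBijExpansion (n : ℕ) {l d : ℕ} (lam : l.Partition) (del : d.Partition)
    (c : (k : ℕ) → k.Partition → ℂ) : Prop :=
  D.mul (S n lam) (S n del) =
    ∑ k ∈ Finset.range (n + 1), ∑ p : k.Partition, c k p • S n p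

/-- The `n`-th term of the sequence `T_p`. These sequences are elements of the projective limit of
the invariant subalgebras of the `D n`, where the product is computed term by term. -/
noncomputable def T {k : ℕ} (p : k.Partition) (n : ℕ) : D n :=
  if k ≤ n then ((n.choose k : ℕ) : ℂ)⁻¹ • S n p else 0

/-- `T_lam ∗ T_del = ∑_p b_p T_p`, an equality of sequences indexed by `n ≥ 1`. The infinite sum
over all partitions `p` has only finitely many nonzero terms in each degree `n`, because the `n`-th
term of `T_p` is `0` for `|p| > n`. -/
def IsUniversalExpansion {l d : ℕ} (lam : l.Partition) (del : d.Partition)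
    (b : (k : ℕ) → k.Partition → ℂ) : Prop :=
  ∀ n : ℕ, 1 ≤ n → D.mul (T lam n) (T del n) =
    ∑ k ∈ Finset.range (n + 1), ∑ p : k.Partition, b k p • T p n

end HeckeS2n

namespace HeckeS2n
open Equiv Function

/-! All three families of coefficients are counts of pairs of permutations, and these reduce to one
count of matchings that does not involve `n`.

Let `s` be the involution exchanging the elements of each pair. The graph of a permutation `w` is
the union of two perfect matchings, `s` and `w⁻¹ * s * w`. With `v = twist w` their product, `s` and
`v` generate a dihedral group, each component consists of two cycles of `v` of equal length, and the
half-length of a component is the minimal period of `v` on it (`IsMatchingPair.pairOrbit_ncard`,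
`PartialBij.count_cosetType`). Fixed points of `v` are the pairs that `w` preserves, that is, the
parts `1`.

For a pair `(w₁, w₂)`, the types of `w₁`, `w₂` and `w₁ * w₂` depend only on `twist w₁` and `twist
w₂⁻¹` (`hasType_twist_mul`), and every fibre of `twist` has `2 ^ n * n!` elements (`card_twist_eq`).
Let `e` be the set of pairs moved by one of these twists. Relabelling `e` by `k = |e|` pairs gives
`n.choose k * pairCount k * (2 ^ n * n!) ^ 2` pairs of permutations with given types and `|e| = k`
(`card_pairs_hasType`). Likewise a proper type of size `k` is carried by `n.choose k * singleCount k
* (2 ^ n * n!)` permutations (`card_hasType`). In the quotient of the two counts the binomial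
cancels, leaving `2 ^ n * n!` times `ratio`, which is independent of `n`.

In the group algebra, a product of type `rho` with `|rho| = |lam| + |del|` forces `|e| = |rho|`,
because the broken pairs of the product number at most `|e|`, and `|e| ≤ |lam| + |del|`
(`card_mul_coeff_K`). So the quotient above is the Hecke coefficient itself. For partial bijections,
the average defining the product is the same count divided by numbers of extensions to permutations
(`PartialBij.basisMul_apply`); properness makes a permutation of type `lam` extend exactly one
partial bijection of coset-type `lam`. Hence `c` and `b` are explicit multiples of the same `ratio`
(`mul_S_apply_eq`, `mul_T_apply`), and the stated identities compare the multiples. -/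

theorem minimalPeriod_of_semiconj {X Y : Type*} {f : X → X} {g : Y → Y} {φ : X → Y}
    (hφ : Injective φ) (h : ∀ x, φ (f x) = g (φ x)) (x : X) :
    minimalPeriod g (φ x) = minimalPeriod f x := by
  have hit : ∀ k, g^[k] (φ x) = φ (f^[k] x) := fun k => by
    induction k with
    | zero => rfl
    | succ k ih => rw [iterate_succ_apply', ih, iterate_succ_apply', h]
  have : ∀ k, IsPeriodicPt g k (φ x) ↔ IsPeriodicPt f k x := fun k => by
    rw [IsPeriodicPt, IsFixedPt, hit, hφ.eq_iff]
    rfl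
  apply Nat.dvd_antisymm
  · rw [← isPeriodicPt_iff_minimalPeriod_dvd, this]
    exact isPeriodicPt_minimalPeriod _ _
  · rw [← isPeriodicPt_iff_minimalPeriod_dvd, ← this]
    exact isPeriodicPt_minimalPeriod _ _

theorem minimalPeriod_inv {X : Type*} (v : Perm X) (x : X) :
    minimalPeriod (v⁻¹ : Perm X) x = minimalPeriod v x := by
  have : ∀ k, IsPeriodicPt (v⁻¹ : Perm X) k x ↔ IsPeriodicPt v k x := fun k => by
    rw [IsPeriodicPt, IsFixedPt, IsPeriodicPt, IsFixedPt, Perm.iterate_eq_pow,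
      Perm.iterate_eq_pow, inv_pow, Perm.inv_eq_iff_eq, eq_comm]
  apply Nat.dvd_antisymm
  · rw [← isPeriodicPt_iff_minimalPeriod_dvd, this]
    exact isPeriodicPt_minimalPeriod _ _
  · rw [← isPeriodicPt_iff_minimalPeriod_dvd, ← this]
    exact isPeriodicPt_minimalPeriod _ _

/-! ### Pairs of matchings and the dihedral group they generate -/

section MatchingPair

variable {X : Type*}

/-- `s` and `s * v` are fixed-point-free involutions. -/
structure IsMatchingPair (s v : Perm X) : Prop where
  sq : ∀ x, s (s x) = x
  sq' : ∀ x, s (v (s (v x))) = x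
  fpf : ∀ x, s x ≠ x
  fpf' : ∀ x, s (v x) ≠ x

namespace IsMatchingPair

variable {s v : Perm X} (h : IsMatchingPair s v)
include h

/-- Both `s` and `s * v` are involutions, so they generate a dihedral group in which `v` is the
rotation. -/
theorem conj_eq : s * v * s⁻¹ = v⁻¹ := by
  have hs : s⁻¹ = s := by ext x; rw [Perm.inv_eq_iff_eq, h.sq]
  rw [eq_inv_iff_mul_eq_one, hs]
  ext x
  exact h.sq' x

theorem apply_zpow (k : ℤ) (x : X) : s ((v ^ k) x) = (v ^ (-k)) (s x) := by
  have h1 : s * v ^ k * s⁻¹ = v ^ (-k) := by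
    rw [← conj_zpow, h.conj_eq, inv_zpow, zpow_neg]
  have h2 : s * v ^ k = v ^ (-k) * s := by rw [← h1]; group
  exact congrArg (fun f : Perm X => f x) h2

/-- The reflection `s * v ^ k` is conjugate by a power of `v` to `s` when `k` is even and to `s * v`
when `k` is odd, and both are fixed-point-free. -/
theorem apply_zpow_ne (k : ℤ) (x : X) : s ((v ^ k) x) ≠ x := by
  intro e
  obtain ⟨i, rfl | rfl⟩ := Int.even_or_odd' k
  · apply h.fpf ((v ^ i) x)
    rw [h.apply_zpow] at e ⊢
    conv_rhs => rw [← e]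
    rw [← Perm.mul_apply (v ^ i), ← zpow_add]
    congr 2
    ring
  · apply h.fpf' ((v ^ i) x)
    rw [← Perm.mul_apply v, ← zpow_one_add]
    rw [h.apply_zpow] at e ⊢
    conv_rhs => rw [← e]
    rw [← Perm.mul_apply (v ^ i), ← zpow_add]
    congr 2
    ring

/-- The cycle of `v` through `x` is disjoint from its mirror image under `s`: an even cycle of edges
splits into two alternating halves. -/
theorem zpow_ne (j k : ℤ) (x : X) : (v ^ j) x ≠ s ((v ^ k) x) := by
  intro e
  apply h.apply_zpow_ne (k + j) x
  rw [h.apply_zpow, neg_add, zpow_add, Perm.mul_apply, ← h.apply_zpow j, zpow_neg,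
    Perm.inv_eq_iff_eq, ← h.sq ((v ^ k) x), ← e]

omit h in
theorem zpow_eq_zpow_iff (v : Perm X) (j k : ℤ) (x : X) :
    (v ^ j) x = (v ^ k) x ↔ (minimalPeriod v x : ℤ) ∣ j - k := by
  have := MulAction.zpow_smul_eq_iff_minimalPeriod_dvd (a := v) (b := x) (n := j - k)
  rw [sub_eq_neg_add, zpow_add, zpow_neg] at this
  rw [sub_eq_neg_add]
  refine Iff.trans ?_ this
  rw [Perm.smul_def, Perm.mul_apply, Perm.inv_eq_iff_eq]

end IsMatchingPair
/-- The component of `x` in the union of the two matchings `s` and `s * v`. -/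
def pairOrbit (s v : Perm X) (x : X) : Set X := {y | ∃ k : ℤ, y = (v ^ k) x ∨ y = s ((v ^ k) x)}

namespace IsMatchingPair

variable {s v : Perm X} (h : IsMatchingPair s v)
include h

/-- A component is a `v`-orbit together with its disjoint mirror image under `s`. This is what turns
half-lengths of cycles into minimal periods. -/
theorem pairOrbit_ncard [Finite X] (x : X) :
    (pairOrbit s v x).ncard = 2 * minimalPeriod v x := by
  have e1 : pairOrbit s v x = MulAction.orbit (Subgroup.zpowers v) x ∪
      s '' MulAction.orbit (Subgroup.zpowers v) x := by
    ext y
    simp only [pairOrbit, Set.mem_ofPred_eq, Set.mem_union, MulAction.mem_orbit_iff,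
      Set.mem_image, Subtype.exists, Subgroup.mem_zpowers_iff, exists_or]
    constructor
    · rintro (⟨k, rfl⟩ | ⟨k, rfl⟩)
      · exact Or.inl ⟨_, ⟨k, rfl⟩, rfl⟩
      · exact Or.inr ⟨_, ⟨_, ⟨k, rfl⟩, rfl⟩, rfl⟩
    · rintro (⟨_, ⟨k, rfl⟩, rfl⟩ | ⟨_, ⟨_, ⟨k, rfl⟩, rfl⟩, rfl⟩)
      · exact Or.inl ⟨k, rfl⟩
      · exact Or.inr ⟨k, rfl⟩
  have e2 : (MulAction.orbit (Subgroup.zpowers v) x).ncard = minimalPeriod v x := by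
    have := Fintype.ofFinite (MulAction.orbit (Subgroup.zpowers v) x)
    have h3 := MulAction.minimalPeriod_eq_card (a := v) (b := x)
    rw [← Nat.card_eq_fintype_card] at h3
    exact h3.symm
  rw [e1, Set.ncard_union_eq, Set.ncard_image_of_injective _ s.injective, e2, two_mul]
  rw [Set.disjoint_left]
  rintro _ ⟨⟨_, j, rfl⟩, rfl⟩ ⟨_, ⟨⟨_, k, rfl⟩, rfl⟩, e⟩
  exact h.zpow_ne j k x e.symm

omit h in
theorem self_mem (x : X) : x ∈ pairOrbit s v x := ⟨0, Or.inl rfl⟩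

theorem apply_s_mem {x y : X} (hy : y ∈ pairOrbit s v x) : s y ∈ pairOrbit s v x := by
  obtain ⟨k, rfl | rfl⟩ := hy
  · exact ⟨k, Or.inr rfl⟩
  · exact ⟨k, Or.inl (h.sq _)⟩

theorem apply_sv_mem {x y : X} (hy : y ∈ pairOrbit s v x) : s (v y) ∈ pairOrbit s v x := by
  obtain ⟨k, rfl | rfl⟩ := hy
  · exact ⟨1 + k, Or.inr (by rw [zpow_one_add]; rfl)⟩
  · refine ⟨-1 + k, Or.inl ?_⟩
    rw [zpow_add, zpow_neg_one, Perm.mul_apply, eq_comm, Perm.inv_eq_iff_eq]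
    apply s.injective
    exact (h.sq' _).symm ▸ rfl

theorem apply_v_mem {x y : X} (hy : y ∈ pairOrbit s v x) : v y ∈ pairOrbit s v x := by
  have := h.apply_s_mem (h.apply_sv_mem hy)
  rwa [h.sq] at this

theorem subset_of_mem {x y : X} (hy : y ∈ pairOrbit s v x) :
    pairOrbit s v y ⊆ pairOrbit s v x := by
  rintro z ⟨k, rfl | rfl⟩ <;> obtain ⟨j, rfl | rfl⟩ := hy
  · exact ⟨k + j, Or.inl (by rw [zpow_add]; rfl)⟩
  · refine ⟨-k + j, Or.inr ?_⟩
    rw [h.apply_zpow (-k + j), h.apply_zpow j, neg_add, neg_neg, zpow_add]; rfl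
  · exact ⟨k + j, Or.inr (by rw [zpow_add]; rfl)⟩
  · refine ⟨-k + j, Or.inl ?_⟩
    rw [h.apply_zpow k, h.sq, zpow_add]; rfl

theorem mem_symm {x y : X} (hy : y ∈ pairOrbit s v x) : x ∈ pairOrbit s v y := by
  obtain ⟨k, rfl | rfl⟩ := hy
  · exact ⟨-k, Or.inl (by rw [← Perm.mul_apply, ← zpow_add]; simp)⟩
  · refine ⟨k, Or.inr ?_⟩
    rw [h.apply_zpow k, h.sq, ← Perm.mul_apply, ← zpow_add]; simp

theorem minimalPeriod_eq [Finite X] {x y : X} (hy : y ∈ pairOrbit s v x) :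
    minimalPeriod v y = minimalPeriod v x := by
  have : pairOrbit s v y = pairOrbit s v x :=
    (h.subset_of_mem hy).antisymm (h.subset_of_mem (h.mem_symm hy))
  have h1 := h.pairOrbit_ncard x
  rw [← this, h.pairOrbit_ncard y] at h1
  omega

end IsMatchingPair
end MatchingPair

/-! ### Classification of pairs of matchings up to isomorphism -/

section Classification

variable {X : Type*} [Finite X]

namespace IsMatchingPair

/-- The equivalence relation of lying in the same component. -/
def setoid {s v : Perm X} (h : IsMatchingPair s v) : Setoid X where
  r x y := y ∈ pairOrbit s v x
  iseqv := ⟨fun x => self_mem x, fun hxy => h.mem_symm hxy,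
    fun hxy hyz => h.subset_of_mem hxy hyz⟩

/-- Each component of period `j` contributes its `2 * j` points, so counting points is counting
components. The colouring `χ` allows the classification to remember an invariant set of points,
later those over the domain of a partial bijection. -/
theorem card_label {s v : Perm X} (h : IsMatchingPair s v) {C : Type*} (χ : X → C)
    (hχ : ∀ x, ∀ y ∈ pairOrbit s v x, χ y = χ x) (j : ℕ) (c : C) :
    Nat.card {x // (minimalPeriod v x, χ x) = (j, c)} =
      2 * j * Nat.card {q : Quotient h.setoid // (minimalPeriod v q.out, χ q.out) = (j, c)} := by
  classical
  have hmk : ∀ x, x ∈ pairOrbit s v (Quotient.mk h.setoid x).out := fun x =>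
    Quotient.exact (s := h.setoid) (Quotient.out_eq (Quotient.mk h.setoid x))
  let e : {x // (minimalPeriod v x, χ x) = (j, c)} ≃
      Σ q : {q : Quotient h.setoid // (minimalPeriod v q.out, χ q.out) = (j, c)},
        pairOrbit s v q.1.out :=
    { toFun := fun x => ⟨⟨Quotient.mk h.setoid x.1, by
          rw [← h.minimalPeriod_eq (hmk x.1), ← hχ _ _ (hmk x.1), x.2]⟩, ⟨x.1, hmk x.1⟩⟩
      invFun := fun q => ⟨q.2.1, by
          rw [h.minimalPeriod_eq q.2.2, hχ _ _ q.2.2, q.1.2]⟩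
      left_inv := fun x => rfl
      right_inv := by
        rintro ⟨⟨q, hq⟩, x, hx⟩
        have : Quotient.mk h.setoid x = q := by
          rw [← Quotient.out_eq q]
          exact (Quotient.sound (s := h.setoid) hx).symm
        subst this
        rfl }
  have : Finite (Quotient h.setoid) := Quotient.finite _
  have := Fintype.ofFinite {q : Quotient h.setoid // (minimalPeriod v q.out, χ q.out) = (j, c)}
  rw [Nat.card_congr e, Nat.card_sigma]
  have : ∀ q : {q : Quotient h.setoid // (minimalPeriod v q.out, χ q.out) = (j, c)},
      Nat.card (pairOrbit s v q.1.out) = 2 * j := fun q => by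
    rw [Nat.card_coe_set_eq, h.pairOrbit_ncard]
    exact congrArg (2 * ·) (Prod.ext_iff.1 q.2).1
  rw [Fintype.sum_congr _ _ this, Finset.sum_const, Finset.card_univ, smul_eq_mul, mul_comm,
    Nat.card_eq_fintype_card]

/-- Two pairs of matchings with the same component statistics are isomorphic. -/
theorem exists_intertwining {s v s' v' : Perm X} (h : IsMatchingPair s v)
    (h' : IsMatchingPair s' v') {C : Type*} (χ χ' : X → C)
    (hχ : ∀ x, ∀ y ∈ pairOrbit s v x, χ y = χ x)
    (hχ' : ∀ x, ∀ y ∈ pairOrbit s' v' x, χ' y = χ' x)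
    (hc : ∀ j c, Nat.card {x // (minimalPeriod v x, χ x) = (j, c)} =
      Nat.card {x // (minimalPeriod v' x, χ' x) = (j, c)}) :
    ∃ φ : Perm X, (∀ x, φ (s x) = s' (φ x)) ∧ (∀ x, φ (v x) = v' (φ x)) ∧
      ∀ x, χ' (φ x) = χ x := by
  classical
  have : Finite (Quotient h.setoid) := Quotient.finite _
  have : Finite (Quotient h'.setoid) := Quotient.finite _
  have hq : ∀ l : ℕ × C, Nonempty
      ({q : Quotient h.setoid // (minimalPeriod v q.out, χ q.out) = l} ≃
        {q : Quotient h'.setoid // (minimalPeriod v' q.out, χ' q.out) = l}) := by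
    rintro ⟨j, c⟩
    -- Period `0` must be treated apart, since the factor `2 * j` cannot be cancelled there; a
    -- permutation of a finite set has no such points.
    rcases Nat.eq_zero_or_pos j with rfl | hj
    · have e1 : IsEmpty {q : Quotient h.setoid // (minimalPeriod v q.out, χ q.out) = (0, c)} :=
        ⟨fun q => (minimalPeriod_pos_of_mem_periodicPts
          (v.injective.mem_periodicPts q.1.out)).ne' (Prod.ext_iff.1 q.2).1⟩
      have e2 : IsEmpty {q : Quotient h'.setoid // (minimalPeriod v' q.out, χ' q.out) = (0, c)} :=
        ⟨fun q => (minimalPeriod_pos_of_mem_periodicPts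
          (v'.injective.mem_periodicPts q.1.out)).ne' (Prod.ext_iff.1 q.2).1⟩
      exact ⟨Equiv.equivOfIsEmpty _ _⟩
    · have := hc j c
      rw [h.card_label χ hχ, h'.card_label χ' hχ'] at this
      exact ⟨(Finite.card_eq.1 (Nat.eq_of_mul_eq_mul_left (by omega) this)).some⟩
  -- Components are matched by period and colour; the isomorphism will send the chosen base point
  -- `x₀` of each component to the base point `y₀` of its partner.
  let e : Quotient h.setoid ≃ Quotient h'.setoid := Equiv.ofFiberEquiv
    (f := fun q => (minimalPeriod v q.out, χ q.out))
    (g := fun q => (minimalPeriod v' q.out, χ' q.out)) fun l => (hq l).some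
  have he : ∀ q : Quotient h.setoid,
      (minimalPeriod v' (e q).out, χ' (e q).out) = (minimalPeriod v q.out, χ q.out) :=
    Equiv.ofFiberEquiv_map (f := fun q : Quotient h.setoid => (minimalPeriod v q.out, χ q.out))
      (g := fun q : Quotient h'.setoid => (minimalPeriod v' q.out, χ' q.out)) _
  let x₀ : X → X := fun x => (Quotient.mk h.setoid x).out
  let y₀ : X → X := fun x => (e (Quotient.mk h.setoid x)).out
  have hmk : ∀ x, x ∈ pairOrbit s v (x₀ x) := fun x =>
    Quotient.exact (s := h.setoid) (Quotient.out_eq (Quotient.mk h.setoid x))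
  have hper : ∀ x, minimalPeriod v' (y₀ x) = minimalPeriod v (x₀ x) := fun x =>
    (Prod.ext_iff.1 (he (Quotient.mk h.setoid x))).1
  have hcol : ∀ x, χ' (y₀ x) = χ (x₀ x) := fun x =>
    (Prod.ext_iff.1 (he (Quotient.mk h.setoid x))).2
  have hz : ∀ x (j k : ℤ), (v ^ j) (x₀ x) = (v ^ k) (x₀ x) ↔
      (v' ^ j) (y₀ x) = (v' ^ k) (y₀ x) := fun x j k => by
    rw [zpow_eq_zpow_iff, zpow_eq_zpow_iff, hper]
  -- the graph of the isomorphism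
  let R : X → X → Prop := fun x y => ∃ k : ℤ, (x = (v ^ k) (x₀ x) ∧ y = (v' ^ k) (y₀ x)) ∨
    (x = s ((v ^ k) (x₀ x)) ∧ y = s' ((v' ^ k) (y₀ x)))
  have hex : ∀ x, ∃ y, R x y := fun x => by
    obtain ⟨k, hk | hk⟩ := hmk x
    · exact ⟨_, k, Or.inl ⟨hk, rfl⟩⟩
    · exact ⟨_, k, Or.inr ⟨hk, rfl⟩⟩
  -- The exponent is determined only modulo the period, which is common to both sides by `hz`; a
  -- mixture of the two cycles is excluded by `zpow_ne`.
  have huniq : ∀ x y y', R x y → R x y' → y = y' := by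
    rintro x y y' ⟨k, ⟨h1, rfl⟩ | ⟨h1, rfl⟩⟩ ⟨j, ⟨h2, rfl⟩ | ⟨h2, rfl⟩⟩
    · exact (hz x k j).1 (h1.symm.trans h2)
    · exact absurd (h1.symm.trans h2) (h.zpow_ne k j _)
    · exact absurd (h2.symm.trans h1) (h.zpow_ne j k _)
    · rw [(hz x k j).1 (s.injective (h1.symm.trans h2))]
  choose f hf using hex
  have hsame : ∀ {x x'}, x' ∈ pairOrbit s v x → x₀ x' = x₀ x ∧ y₀ x' = y₀ x := fun hx => by
    have := Quotient.sound (s := h.setoid) hx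
    exact ⟨by simp only [x₀, this], by simp only [y₀, this]⟩
  have hmem : ∀ x, f x ∈ pairOrbit s' v' (y₀ x) := fun x => by
    obtain ⟨k, ⟨-, h1⟩ | ⟨-, h1⟩⟩ := hf x
    · exact ⟨k, Or.inl h1⟩
    · exact ⟨k, Or.inr h1⟩
  have hfs : ∀ x, f (s x) = s' (f x) := fun x => by
    apply huniq (s x) _ _ (hf _)
    obtain ⟨e1, e2⟩ := hsame (h.apply_s_mem (self_mem x))
    simp only [R, e1, e2]
    obtain ⟨k, ⟨h1, h2⟩ | ⟨h1, h2⟩⟩ := hf x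
    · exact ⟨k, Or.inr ⟨congrArg s h1, congrArg s' h2⟩⟩
    · exact ⟨k, Or.inl ⟨(congrArg s h1).trans (h.sq _), (congrArg s' h2).trans (h'.sq _)⟩⟩
  have hfsv : ∀ x, f (v x) = v' (f x) := fun x => by
    apply huniq (v x) _ _ (hf _)
    obtain ⟨e1, e2⟩ := hsame (h.apply_v_mem (self_mem x))
    simp only [R, e1, e2]
    obtain ⟨k, ⟨h1, h2⟩ | ⟨h1, h2⟩⟩ := hf x
    · refine ⟨1 + k, Or.inl ⟨(congrArg v h1).trans ?_, (congrArg v' h2).trans ?_⟩⟩ <;>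
        rw [zpow_one_add] <;> rfl
    -- On the mirror cycle `v` runs backwards.
    · have key : ∀ {s v : Perm X} (h : IsMatchingPair s v) (z : X),
          v (s ((v ^ k) z)) = s ((v ^ (-1 + k)) z) := fun {s v} h z => by
        rw [h.apply_zpow, h.apply_zpow, ← Perm.mul_apply, ← zpow_one_add, neg_add, neg_neg]
      exact ⟨-1 + k, Or.inr ⟨(congrArg v h1).trans (key h _), (congrArg v' h2).trans (key h' _)⟩⟩
  -- Equal images lie in one target component, and `e` is injective on components, so both points
  -- have the same base point and their exponents can be compared.
  have hinj : Function.Injective f := fun x x' hxx => by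
    have h1 : y₀ x' ∈ pairOrbit s' v' (y₀ x) :=
      h'.subset_of_mem (hmem x) (hxx ▸ h'.mem_symm (hmem x'))
    have h2 := Quotient.sound (s := h'.setoid) h1
    simp only [y₀, Quotient.out_eq] at h2
    have h3 := e.injective h2
    have ex : x₀ x' = x₀ x := by simp only [x₀, h3]
    have ey : y₀ x' = y₀ x := by simp only [y₀, h3]
    obtain ⟨k, ⟨h1, h2⟩ | ⟨h1, h2⟩⟩ := hf x <;> obtain ⟨j, ⟨h3, h4⟩ | ⟨h3, h4⟩⟩ := hf x' <;>
      rw [ex] at h3 <;> rw [ey] at h4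
    · rw [h1, h3, hz, ← h2, ← h4, hxx]
    · exact absurd (h2.symm.trans (hxx.trans h4)) (h'.zpow_ne k j _)
    · exact absurd (h4.symm.trans (hxx.symm.trans h2)) (h'.zpow_ne j k _)
    · rw [h1, h3, s.injective.eq_iff, hz, ← s'.injective.eq_iff, ← h2, ← h4, hxx]
  refine ⟨Equiv.ofBijective f (Finite.injective_iff_bijective.1 hinj), hfs, hfsv, fun x => ?_⟩
  rw [hχ _ _ (hmk x), ← hcol]
  exact hχ' _ _ (hmem x)

end IsMatchingPair
end Classification

/-! ### The coset graph read through `twist` -/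

section Twist

theorem perm_inv_apply_self {X : Type*} (f : Perm X) (x : X) : f⁻¹ (f x) = x :=
  f.symm_apply_apply x

theorem perm_apply_inv_self {X : Type*} (f : Perm X) (x : X) : f (f⁻¹ x) = x :=
  f.apply_symm_apply x

variable {n : ℕ}

/-- The involution exchanging the two elements of every pair. -/
def swap (n : ℕ) : Perm (Pt n) where
  toFun x := (x.1, !x.2)
  invFun x := (x.1, !x.2)
  left_inv x := by simp
  right_inv x := by simp

@[simp] theorem swap_fst (x : Pt n) : (swap n x).1 = x.1 := rfl

@[simp] theorem swap_swap (x : Pt n) : swap n (swap n x) = x := by simp [swap]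

@[simp] theorem swap_inv : (swap n)⁻¹ = swap n := by ext x <;> rfl

theorem swap_ne (x : Pt n) : swap n x ≠ x := by
  obtain ⟨i, b⟩ := x
  simp [swap]

theorem eq_or_eq_swap {x y : Pt n} (h : x.1 = y.1) : y = x ∨ y = swap n x := by
  obtain ⟨i, b⟩ := x
  obtain ⟨j, c⟩ := y
  obtain rfl : i = j := h
  cases b <;> cases c <;> simp [swap]

/-- The product of the two matchings of `[2n]` given by the pairs and by the preimages of the
pairs under `w`. -/
def twist (w : Perm (Pt n)) : Perm (Pt n) := swap n * w⁻¹ * swap n * w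

theorem twist_apply (w : Perm (Pt n)) (x : Pt n) :
    twist w x = swap n (w⁻¹ (swap n (w x))) := rfl

theorem swap_twist (w : Perm (Pt n)) (x : Pt n) :
    swap n (twist w x) = w⁻¹ (swap n (w x)) := by rw [twist_apply, swap_swap]

theorem isMatchingPair_twist (w : Perm (Pt n)) : IsMatchingPair (swap n) (twist w) where
  sq := swap_swap
  sq' x := by simp [swap_twist]
  fpf := swap_ne
  fpf' x := by
    rw [swap_twist, Ne, Perm.inv_eq_iff_eq]
    exact (swap_ne _)

/-- `w` maps the pair of `x` to a pair. -/
def PreservesPair (w : Perm (Pt n)) (x : Pt n) : Prop := w (swap n x) = swap n (w x)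

/-- A preserved pair carries both an exterior and an interior edge: it is a two-vertex cycle, a part
`1` of the coset-type. -/
theorem preservesPair_iff (w : Perm (Pt n)) (x : Pt n) :
    PreservesPair w x ↔ twist w x = x := by
  rw [twist_apply, PreservesPair, ← (swap n).injective.eq_iff (b := x), swap_swap,
    Perm.inv_eq_iff_eq, eq_comm]

theorem PreservesPair.swap {w : Perm (Pt n)} {x : Pt n} (h : PreservesPair w x) :
    PreservesPair w (swap n x) := by
  rw [PreservesPair] at h ⊢
  rw [h, swap_swap, swap_swap]

theorem preservesPair_swap {w : Perm (Pt n)} {x : Pt n} :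
    PreservesPair w (HeckeS2n.swap n x) ↔ PreservesPair w x :=
  ⟨fun h => by simpa using h.swap, fun h => h.swap⟩

theorem preservesPair_congr {w : Perm (Pt n)} {x y : Pt n} (h : x.1 = y.1) :
    PreservesPair w x ↔ PreservesPair w y := by
  obtain rfl | rfl := eq_or_eq_swap h
  · rfl
  · exact preservesPair_swap.symm

theorem PreservesPair.mul {w₁ w₂ : Perm (Pt n)} {x : Pt n} (h₁ : PreservesPair w₁ (w₂ x))
    (h₂ : PreservesPair w₂ x) : PreservesPair (w₁ * w₂) x := by
  rw [PreservesPair] at *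
  rw [Perm.mul_apply, h₂, h₁, Perm.mul_apply]

theorem preservesPair_inv {w : Perm (Pt n)} {x : Pt n} :
    PreservesPair w⁻¹ (w x) ↔ PreservesPair w x := by
  rw [PreservesPair, PreservesPair, Perm.inv_eq_iff_eq, perm_inv_apply_self, eq_comm]

namespace PartialBij

variable {a : PartialBij n} {w : Perm (Pt n)}

theorem le_iff (a : PartialBij n) (w : Perm (Pt n)) :
    a.map ≤ w.toPEquiv ↔ ∀ x, x.1 ∈ a.dom → a.map x = some (w x) := by
  constructor
  · intro h x hx
    obtain ⟨y, hy⟩ := Option.isSome_iff_exists.1 ((isSome_map_iff a x).2 hx)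
    have := h x y hy
    rw [Equiv.toPEquiv_apply, Option.mem_some_iff] at this
    rw [hy, this]
  · intro h x y hy
    have hx := (isSome_map_iff a x).1 (Option.isSome_iff_exists.2 ⟨y, hy⟩)
    rw [Equiv.toPEquiv_apply, ← h x hx]
    exact hy

theorem mem_cod_iff (h : a.map ≤ w.toPEquiv) (x : Pt n) : (w x).1 ∈ a.cod ↔ x.1 ∈ a.dom := by
  rw [← isSome_symm_iff, ← isSome_map_iff]
  constructor
  · intro hx
    obtain ⟨y, hy⟩ := Option.isSome_iff_exists.1 hx
    have hy' : w x ∈ a.map y := (PEquiv.mem_iff_mem a.map).1 hy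
    have := h y _ hy'
    rw [Equiv.toPEquiv_apply, Option.mem_some_iff, w.injective.eq_iff] at this
    subst this
    exact Option.isSome_iff_exists.2 ⟨_, hy'⟩
  · intro hx
    have := (le_iff a w).1 h x ((isSome_map_iff a x).1 hx)
    exact Option.isSome_iff_exists.2 ⟨x, (PEquiv.mem_iff_mem a.map).2 this⟩

theorem mem_cod_iff' (h : a.map ≤ w.toPEquiv) (y : Pt n) : (w⁻¹ y).1 ∈ a.dom ↔ y.1 ∈ a.cod := by
  rw [← mem_cod_iff h, perm_apply_inv_self]

theorem swap_twist_mem_dom (h : a.map ≤ w.toPEquiv) {x : Pt n} (hx : x.1 ∈ a.dom) :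
    (swap n (twist w x)).1 ∈ a.dom := by
  rw [swap_twist, mem_cod_iff' h, swap_fst, mem_cod_iff h]
  exact hx

theorem twist_mem_dom (h : a.map ≤ w.toPEquiv) {x : Pt n} (hx : x.1 ∈ a.dom) :
    (twist w x).1 ∈ a.dom := swap_twist_mem_dom h hx

theorem mem_dom_of_mem_pairOrbit (h : a.map ≤ w.toPEquiv) {x y : Pt n} (hx : x.1 ∈ a.dom)
    (hy : y ∈ pairOrbit (swap n) (twist w) x) : y.1 ∈ a.dom := by
  have hm := isMatchingPair_twist w
  have key : ∀ k : ℤ, ((twist w ^ k) x).1 ∈ a.dom := by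
    intro k
    induction k using Int.induction_on with
    | zero => exact hx
    | succ k ih =>
      rw [add_comm, zpow_one_add]
      exact twist_mem_dom h ih
    -- Negative powers follow from `s * v * s = v⁻¹`.
    | pred k ih =>
      have e : swap n (twist w (swap n ((twist w ^ (-(k : ℤ))) x))) =
          (twist w ^ (-(k : ℤ) - 1)) x := by
        rw [sub_eq_neg_add, zpow_add, zpow_neg_one, Perm.mul_apply, Perm.eq_inv_iff_eq]
        exact (swap n).injective (hm.sq' (swap n _))
      rw [← e]
      exact twist_mem_dom h ih
  obtain ⟨k, rfl | rfl⟩ := hy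
  · exact key k
  · exact key k

theorem mem_dom_iff_of_mem_pairOrbit (h : a.map ≤ w.toPEquiv) {x y : Pt n}
    (hy : y ∈ pairOrbit (swap n) (twist w) x) : y.1 ∈ a.dom ↔ x.1 ∈ a.dom :=
  ⟨fun hx => mem_dom_of_mem_pairOrbit h hx ((isMatchingPair_twist w).mem_symm hy),
    fun hx => mem_dom_of_mem_pairOrbit h hx hy⟩

theorem cosetGraph_adj (h : a.map ≤ w.toPEquiv) (x y : {x : Pt n // (a.map x).isSome}) :
    (cosetGraph a.map).Adj x y ↔ y.1 = swap n x.1 ∨ y.1 = swap n (twist w x.1) := by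
  have hg : ∀ x : {x : Pt n // (a.map x).isSome}, (a.map x.1).get x.2 = w x.1 := fun x => by
    have := (le_iff a w).1 h x.1 ((isSome_map_iff a _).1 x.2)
    simp [this]
  simp only [cosetGraph, hg]
  constructor
  · rintro ⟨hne, h1 | h1⟩
    · exact Or.inl ((eq_or_eq_swap h1).resolve_left fun e => hne (Subtype.ext e.symm))
    · refine Or.inr ((eq_or_eq_swap h1).elim
        (fun e => absurd (Subtype.ext (w.injective e).symm) hne) fun e => ?_)
      rw [swap_twist, Perm.eq_inv_iff_eq, e]
  · rintro (h1 | h1)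
    · refine ⟨fun e => swap_ne x.1 (h1.symm.trans (congrArg _ e.symm)), Or.inl ?_⟩
      rw [h1, swap_fst]
    · refine ⟨fun e => (isMatchingPair_twist w).fpf' x.1 (h1.symm.trans (congrArg _ e.symm)),
        Or.inr ?_⟩
      rw [h1, swap_twist, perm_apply_inv_self, swap_fst]

/-- Edges are steps by `swap` and by `swap` after `twist`. The domain is closed under both, so
components of the graph of `a` are full dihedral orbits on `[2n]`. -/
theorem reachable_iff (h : a.map ≤ w.toPEquiv) (x y : {x : Pt n // (a.map x).isSome}) :
    (cosetGraph a.map).Reachable x y ↔ y.1 ∈ pairOrbit (swap n) (twist w) x.1 := by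
  have hm := isMatchingPair_twist w
  constructor
  · rintro ⟨p⟩
    induction p with
    | nil => exact IsMatchingPair.self_mem _
    | cons hadj _ ih =>
      refine hm.subset_of_mem ?_ ih
      obtain e | e := (cosetGraph_adj h _ _).1 hadj
      · rw [e]; exact hm.apply_s_mem (IsMatchingPair.self_mem _)
      · rw [e]; exact hm.apply_sv_mem (IsMatchingPair.self_mem _)
  · have hs : ∀ z : Pt n, (a.map z).isSome → (a.map (swap n z)).isSome := fun z hz => by
      rw [isSome_map_iff] at hz ⊢; exact hz
    have ht : ∀ z : Pt n, (a.map z).isSome → (a.map (twist w z)).isSome := fun z hz => by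
      rw [isSome_map_iff] at hz ⊢; exact twist_mem_dom h hz
    let P : Pt n → Prop := fun z => ∃ hz, (cosetGraph a.map).Reachable x ⟨z, hz⟩
    have Ps : ∀ z, P z → P (swap n z) := fun z ⟨hz, hr⟩ =>
      ⟨hs z hz, hr.trans ((cosetGraph_adj h _ _).2 (Or.inl rfl)).reachable⟩
    have Pt' : ∀ z, P z → P (swap n (twist w z)) := fun z ⟨hz, hr⟩ =>
      ⟨hs _ (ht z hz), hr.trans ((cosetGraph_adj h _ _).2 (Or.inr rfl)).reachable⟩
    have key : ∀ k : ℤ, P ((twist w ^ k) x.1) := by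
      intro k
      induction k using Int.induction_on with
      | zero => exact ⟨x.2, SimpleGraph.Reachable.refl _⟩
      | succ k ih =>
        rw [add_comm, zpow_one_add]
        have := Ps _ (Pt' _ ih)
        rwa [swap_swap] at this
      | pred k ih =>
        have e : swap n (twist w (swap n ((twist w ^ (-(k : ℤ))) x))) =
            (twist w ^ (-(k : ℤ) - 1)) x := by
          rw [sub_eq_neg_add, zpow_add, zpow_neg_one, Perm.mul_apply, Perm.eq_inv_iff_eq]
          exact (swap n).injective (hm.sq' (swap n _))
        rw [← e]
        exact Pt' _ (Ps _ ih)
    rintro ⟨k, hk | hk⟩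
    · obtain ⟨_, hr⟩ := key k
      convert hr
    · obtain ⟨_, hr⟩ := Ps _ (key k)
      convert hr

theorem card_supp (h : a.map ≤ w.toPEquiv) (x : {x : Pt n // (a.map x).isSome}) :
    Nat.card ((cosetGraph a.map).connectedComponentMk x).supp =
      2 * minimalPeriod (twist w) x.1 := by
  rw [← (isMatchingPair_twist w).pairOrbit_ncard, Nat.card_coe_set_eq,
    ← Set.ncard_image_of_injective _ Subtype.val_injective]
  congr 1
  ext y
  simp only [Set.mem_image, SimpleGraph.ConnectedComponent.mem_supp_iff,
    SimpleGraph.ConnectedComponent.eq]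
  constructor
  · rintro ⟨z, hz, rfl⟩
    exact (reachable_iff h _ _).1 hz.symm
  · intro hy
    have hd : (a.map y).isSome := by
      rw [isSome_map_iff, mem_dom_iff_of_mem_pairOrbit h hy, ← isSome_map_iff]
      exact x.2
    exact ⟨⟨y, hd⟩, ((reachable_iff h _ ⟨y, hd⟩).2 hy).symm, rfl⟩

end PartialBij

/-- The number of points over `d` on cycles of length `j` of `v`. -/
noncomputable def stat (v : Perm (Pt n)) (d : Finset (Fin n)) (j : ℕ) : ℕ :=
  Nat.card {x : Pt n // x.1 ∈ d ∧ minimalPeriod v x = j}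

namespace PartialBij

variable {a : PartialBij n} {w : Perm (Pt n)}

theorem pos_of_mem_cosetType (h : a.map ≤ w.toPEquiv) {j : ℕ} (hj : j ∈ cosetType a.map) :
    0 < j := by
  simp only [cosetType, Multiset.mem_map] at hj
  obtain ⟨C, -, rfl⟩ := hj
  induction C using SimpleGraph.ConnectedComponent.ind with
  | h x =>
    rw [card_supp h, Nat.mul_div_cancel_left _ two_pos]
    exact minimalPeriod_pos_of_mem_periodicPts ((twist w).injective.mem_periodicPts x.1)

/-- Each part `j` accounts for the `2 * j` vertices of its cycle. Any permutation extending `a`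
computes the coset-type, since only points over `a.dom` are counted. -/
theorem count_cosetType (h : a.map ≤ w.toPEquiv) (j : ℕ) :
    stat (twist w) a.dom j = (cosetType a.map).count j * (2 * j) := by
  classical
  let e : {x : Pt n // x.1 ∈ a.dom ∧ minimalPeriod (twist w) x = j} ≃
      Σ C : {C : (cosetGraph a.map).ConnectedComponent // j = Nat.card C.supp / 2},
        C.1.supp :=
    { toFun := fun x => ⟨⟨(cosetGraph a.map).connectedComponentMk
          ⟨x.1, (isSome_map_iff a _).2 x.2.1⟩, by
            rw [card_supp h, Nat.mul_div_cancel_left _ two_pos, x.2.2]⟩,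
          ⟨⟨x.1, (isSome_map_iff a _).2 x.2.1⟩, rfl⟩⟩
      invFun := fun C => ⟨C.2.1.1, (isSome_map_iff a _).1 C.2.1.2, by
          have h1 := C.1.2
          rw [← C.2.2, card_supp h, Nat.mul_div_cancel_left _ two_pos] at h1
          exact h1.symm⟩
      left_inv := fun x => rfl
      right_inv := by
        rintro ⟨⟨C, hC⟩, x, hx⟩
        obtain rfl : _ = C := hx
        rfl }
  rw [stat, Nat.card_congr e, Nat.card_sigma]
  have : ∀ C : {C : (cosetGraph a.map).ConnectedComponent // j = Nat.card C.supp / 2},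
      Nat.card C.1.supp = 2 * j := by
    rintro ⟨C, hC⟩
    induction C using SimpleGraph.ConnectedComponent.ind with
    | h x =>
      simp only [card_supp h, Nat.mul_div_cancel_left _ two_pos] at hC ⊢
      rw [hC]
  rw [Fintype.sum_congr _ _ this, Finset.sum_const, Finset.card_univ, smul_eq_mul, cosetType,
    Multiset.count_map, Fintype.card_subtype]
  congr

end PartialBij
end Twist

/-! ### Transport along an enumeration of a set of pairs -/

section Lift

variable {m n : ℕ}

/-- Extension of permutations along an injection of the indices of the pairs. -/
noncomputable def lift (f : Fin m ↪ Fin n) : Perm (Pt m) →* Perm (Pt n) :=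
  Perm.viaEmbeddingHom (f.prodMap (Embedding.refl Bool))

theorem lift_apply (f : Fin m ↪ Fin n) (g : Perm (Pt m)) (x : Pt m) :
    lift f g (f x.1, x.2) = (f (g x).1, (g x).2) :=
  Perm.viaEmbedding_apply g (f.prodMap (Embedding.refl Bool)) x

theorem lift_apply_of_notMem (f : Fin m ↪ Fin n) (g : Perm (Pt m)) {x : Pt n}
    (hx : x.1 ∉ Set.range f) : lift f g x = x :=
  Perm.viaEmbedding_apply_of_notMem g (f.prodMap (Embedding.refl Bool)) x (by
    rintro ⟨y, rfl⟩
    exact hx ⟨y.1, rfl⟩)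

theorem lift_injective (f : Fin m ↪ Fin n) : Injective (lift f) :=
  Perm.viaEmbeddingHom_injective _

theorem pair_cases (f : Fin m ↪ Fin n) (x : Pt n) :
    x.1 ∉ Set.range f ∨ ∃ y : Pt m, x = (f y.1, y.2) := by
  by_cases h : x.1 ∈ Set.range f
  · obtain ⟨i, hi⟩ := h
    exact Or.inr ⟨(i, x.2), Prod.ext hi.symm rfl⟩
  · exact Or.inl h

theorem embed_inj (f : Fin m ↪ Fin n) {x y : Pt m} :
    ((f x.1, x.2) : Pt n) = (f y.1, y.2) ↔ x = y := by
  rw [Prod.ext_iff, Prod.ext_iff, f.injective.eq_iff]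

/-- A permutation fixing everything outside the image of `f` cannot send a point of the image
outside, as that value is already taken by a fixed point. -/
theorem exists_lift (f : Fin m ↪ Fin n) (g : Perm (Pt n))
    (h : ∀ x : Pt n, x.1 ∉ Set.range f → g x = x) : ∃ g', lift f g' = g := by
  have hmem : ∀ y : Pt m, ∃ z : Pt m, g (f y.1, y.2) = (f z.1, z.2) := fun y => by
    obtain h1 | h1 := pair_cases f (g (f y.1, y.2))
    · have := g.injective (h _ h1)
      rw [this] at h1
      exact absurd ⟨y.1, rfl⟩ h1
    · exact h1
  choose φ hφ using hmem
  have hinj : Injective φ := fun y z hyz => by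
    have := (hφ y).trans ((congrArg (fun t : Pt m => ((f t.1, t.2) : Pt n)) hyz).trans
      (hφ z).symm)
    exact (embed_inj f).1 (g.injective this)
  refine ⟨Equiv.ofBijective φ (Finite.injective_iff_bijective.1 hinj), ?_⟩
  ext1 x
  obtain hx | ⟨y, rfl⟩ := pair_cases f x
  · rw [lift_apply_of_notMem f _ hx, h x hx]
  · rw [lift_apply, hφ]
    rfl

theorem swap_embed (f : Fin m ↪ Fin n) (x : Pt m) :
    swap n (f x.1, x.2) = (f (swap m x).1, (swap m x).2) := rfl

theorem minimalPeriod_lift (f : Fin m ↪ Fin n) (g : Perm (Pt m)) (x : Pt m) :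
    minimalPeriod (lift f g) (f x.1, x.2) = minimalPeriod g x :=
  minimalPeriod_of_semiconj (φ := fun x : Pt m => ((f x.1, x.2) : Pt n))
    (fun _ _ h => (embed_inj f).1 h) (fun y => (lift_apply f g y).symm) x

theorem minimalPeriod_eq_one {v : Perm (Pt n)} {x : Pt n} :
    minimalPeriod v x = 1 ↔ v x = x := minimalPeriod_eq_one_iff_isFixedPt

/-- The cycles of `v` of length at least `2` come in pairs of cycles of the same length, whose
lengths are the parts of `p` different from `1`. -/
def HasType (v : Perm (Pt n)) (p : Multiset ℕ) : Prop :=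
  ∀ j, 2 ≤ j → stat v Finset.univ j = p.count j * (2 * j)

/-- Lifting adds only points of period `1`. This is why types are recorded only for `j ≥ 2`: they
then do not depend on the number of pairs of the ambient set. -/
theorem stat_lift (f : Fin m ↪ Fin n) (g : Perm (Pt m)) {j : ℕ} (hj : 2 ≤ j) :
    stat (lift f g) Finset.univ j = stat g Finset.univ j := by
  symm
  refine Nat.card_eq_of_bijective
    (fun x => ⟨(f x.1.1, x.1.2), Finset.mem_univ _, (minimalPeriod_lift f g x.1).trans x.2.2⟩)
    ⟨fun x y h => Subtype.ext ((embed_inj f).1 (congrArg Subtype.val h)), ?_⟩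
  rintro ⟨x, hx, hxj⟩
  obtain h | ⟨y, rfl⟩ := pair_cases f x
  · have := minimalPeriod_eq_one.2 (lift_apply_of_notMem f g h)
    omega
  · exact ⟨⟨y, Finset.mem_univ _, (minimalPeriod_lift f g y).symm.trans hxj⟩, rfl⟩

theorem hasType_lift (f : Fin m ↪ Fin n) (g : Perm (Pt m)) (p : Multiset ℕ) :
    HasType (lift f g) p ↔ HasType g p :=
  forall₂_congr fun j hj => by rw [stat_lift f g hj]

/-- The number of permutations that map pairs to pairs. -/
theorem card_forall_preservesPair (m : ℕ) :
    Nat.card {g : Perm (Pt m) // ∀ x, PreservesPair g x} = 2 ^ m * m.factorial := by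
  have e : Nat.card (Perm (Fin m) × (Fin m → Perm Bool)) = 2 ^ m * m.factorial := by
    rw [Nat.card_prod, Nat.card_pi, Nat.card_perm, Nat.card_perm]
    simp [mul_comm]
  rw [← e]
  symm
  have hb : ∀ (ε : Perm Bool) (b : Bool), ε (!b) = !(ε b) := by decide
  -- A pair-preserving permutation permutes the pairs and, independently in each pair, flips or
  -- keeps its two elements: this is the hyperoctahedral group.
  refine Nat.card_eq_of_bijective (fun q => ⟨Equiv.prodShear q.1 q.2, fun x => ?_⟩) ⟨?_, ?_⟩
  · exact Prod.ext rfl (hb _ _)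
  · rintro ⟨π, ε⟩ ⟨π', ε'⟩ h
    have h1 : ∀ x : Pt m, ((π x.1, ε x.1 x.2) : Pt m) = (π' x.1, ε' x.1 x.2) := fun x =>
      congrArg (fun f : Perm (Pt m) => f x) (congrArg Subtype.val h)
    refine Prod.ext (Equiv.ext fun i => (Prod.ext_iff.1 (h1 (i, false))).1)
      (funext fun i => Equiv.ext fun b => (Prod.ext_iff.1 (h1 (i, b))).2)
  · rintro ⟨g, hg⟩
    have hg' : ∀ i b, g (i, !b) = ((g (i, b)).1, !(g (i, b)).2) := fun i b => hg (i, b)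
    have hfst : ∀ i b, (g (i, b)).1 = (g (i, false)).1 := fun i b => by
      cases b
      · rfl
      · have := hg' i false
        rw [Bool.not_false] at this
        rw [this]
    have h1 : Injective fun i => (g (i, false)).1 := fun i j hij => by
      obtain h2 | h2 := eq_or_eq_swap hij
      · exact (Prod.ext_iff.1 (g.injective h2)).1.symm
      · have h3 : g (j, false) = g (swap m (i, false)) := h2.trans (hg _).symm
        exact (Prod.ext_iff.1 (g.injective h3)).1.symm
    have h2 : ∀ i, Injective fun b => (g (i, b)).2 := fun i b c hbc => by
      have : g (i, b) = g (i, c) := Prod.ext ((hfst i b).trans (hfst i c).symm) hbc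
      exact (Prod.ext_iff.1 (g.injective this)).2
    refine ⟨(Equiv.ofBijective _ (Finite.injective_iff_bijective.1 h1),
      fun i => Equiv.ofBijective _ (Finite.injective_iff_bijective.1 (h2 i))), ?_⟩
    apply Subtype.ext
    ext1 ⟨i, b⟩
    exact Prod.ext (hfst i b).symm rfl

/-- An enumeration of the elements of a finite set of indices. -/
noncomputable def enum (e : Finset (Fin n)) (h : e.card = m) : Fin m ↪ Fin n :=
  (e.orderEmbOfFin h).toEmbedding

theorem mem_range_enum {e : Finset (Fin n)} (h : e.card = m) (i : Fin n) :
    i ∈ Set.range (enum e h) ↔ i ∈ e := by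
  rw [← Finset.mem_coe, ← Finset.range_orderEmbOfFin e h]
  rfl

end Lift

/-! ### Extending partial bijections to permutations -/

namespace PartialBij

variable {n : ℕ}

/-- The permutation `w` extends `a` and maps the pairs outside the domain of `a` to pairs. -/
def Extends (a : PartialBij n) (w : Perm (Pt n)) : Prop :=
  a.map ≤ w.toPEquiv ∧ ∀ x : Pt n, x.1 ∉ a.dom → PreservesPair w x

/-- A partial bijection as a bijection of its domain with its codomain. -/
def domEquivCod (a : PartialBij n) : {x : Pt n // x.1 ∈ a.dom} ≃ {y : Pt n // y.1 ∈ a.cod} where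
  toFun x := ⟨(a.map x.1).get ((isSome_map_iff a _).2 x.2), by
    rw [← isSome_symm_iff]
    exact Option.isSome_iff_exists.2 ⟨x.1, (PEquiv.mem_iff_mem a.map).2 (Option.get_mem _)⟩⟩
  invFun y := ⟨(a.map.symm y.1).get ((isSome_symm_iff a _).2 y.2), by
    rw [← isSome_map_iff]
    exact Option.isSome_iff_exists.2 ⟨y.1, (PEquiv.mem_iff_mem a.map).1 (Option.get_mem _)⟩⟩
  left_inv x := Subtype.ext (Option.get_of_mem _
    ((PEquiv.mem_iff_mem a.map).2 (Option.get_mem _)))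
  right_inv y := Subtype.ext (Option.get_of_mem _
    ((PEquiv.mem_iff_mem a.map).1 (Option.get_mem _)))

theorem card_over (e : Finset (Fin n)) : Nat.card {x : Pt n // x.1 ∈ e} = e.card * 2 := by
  have : {x : Pt n // x.1 ∈ e} ≃ e × Bool :=
    { toFun := fun x => (⟨x.1.1, x.2⟩, x.1.2)
      invFun := fun x => ⟨(x.1.1, x.2), x.1.2⟩
      left_inv := fun _ => rfl
      right_inv := fun _ => rfl }
  rw [Nat.card_congr this, Nat.card_prod]
  simp

theorem card_cod (a : PartialBij n) : a.cod.card = a.dom.card := by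
  have := Nat.card_congr a.domEquivCod
  rw [card_over, card_over] at this
  omega

theorem exists_extends (a : PartialBij n) : ∃ w, Extends a w := by
  classical
  have hc : Fintype.card {i // i ∉ a.dom} = Fintype.card {i // i ∉ a.cod} := by
    have h := a.card_cod
    simp [Fintype.card_subtype_compl, h]
  let ε : {i // i ∉ a.dom} ≃ {i // i ∉ a.cod} := Fintype.equivOfCardEq hc
  let f : {x : Pt n // ¬ x.1 ∈ a.dom} ≃ {x : Pt n // ¬ x.1 ∈ a.cod} :=
    { toFun := fun x => ⟨((ε ⟨x.1.1, x.2⟩).1, x.1.2), (ε ⟨x.1.1, x.2⟩).2⟩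
      invFun := fun x => ⟨((ε.symm ⟨x.1.1, x.2⟩).1, x.1.2), (ε.symm ⟨x.1.1, x.2⟩).2⟩
      left_inv := fun x => by simp
      right_inv := fun x => by simp }
  let w : Perm (Pt n) := Equiv.subtypeCongr a.domEquivCod f
  have hin : ∀ x (hx : x.1 ∈ a.dom), w x = (a.domEquivCod ⟨x, hx⟩).1 := fun x hx => by
    simp [w, Equiv.subtypeCongr, Equiv.sumCompl, hx]
  have hout : ∀ x (hx : x.1 ∉ a.dom), w x = (f ⟨x, hx⟩).1 := fun x hx => by
    simp [w, Equiv.subtypeCongr, Equiv.sumCompl, hx]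
  refine ⟨w, (le_iff a w).2 fun x hx => ?_, fun x hx => ?_⟩
  · rw [hin x hx]
    exact (Option.some_get _).symm
  · rw [PreservesPair, hout x hx, hout _ (by exact hx)]
    rfl

/-- The number of trivial extensions of `a` to a permutation. -/
theorem card_extends (a : PartialBij n) :
    Nat.card {w // Extends a w} = 2 ^ (n - a.dom.card) * (n - a.dom.card).factorial := by
  obtain ⟨w₀, h₀⟩ := a.exists_extends
  have hc : (a.domᶜ).card = n - a.dom.card := by rw [Finset.card_compl, Fintype.card_fin]
  rw [← card_forall_preservesPair]
  symm
  have hr : ∀ i, i ∈ Set.range (enum _ hc) ↔ i ∉ a.dom := fun i => by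
    rw [mem_range_enum, Finset.mem_compl]
  have hpp : ∀ g : Perm (Pt (n - a.dom.card)), (∀ x, PreservesPair g x) →
      ∀ x, PreservesPair (lift (enum _ hc) g) x := fun g hg x => by
    obtain hx | ⟨y, rfl⟩ := pair_cases (enum _ hc) x
    · rw [PreservesPair, lift_apply_of_notMem _ _ hx, lift_apply_of_notMem _ _ (by exact hx)]
    · rw [PreservesPair, swap_embed, lift_apply, lift_apply, swap_embed, hg y]
  -- The extensions of `a` are `w₀` times the pair-preserving permutations supported on the pairs
  -- outside the domain.
  refine Nat.card_eq_of_bijective (fun g => ⟨w₀ * lift (enum _ hc) g.1, ?_, ?_⟩) ⟨?_, ?_⟩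
  · rw [le_iff]
    intro x hx
    rw [Perm.mul_apply, lift_apply_of_notMem, (le_iff a w₀).1 h₀.1 x hx]
    rwa [hr, not_not]
  · intro x hx
    refine PreservesPair.mul (h₀.2 _ ?_) (hpp g.1 g.2 x)
    obtain hx' | ⟨y, rfl⟩ := pair_cases (enum _ hc) x
    · rwa [lift_apply_of_notMem _ _ hx']
    · rw [lift_apply, ← hr]
      exact ⟨_, rfl⟩
  · intro g g' h
    exact Subtype.ext (lift_injective _ (mul_left_cancel (congrArg Subtype.val h)))
  · rintro ⟨w, hw⟩
    obtain ⟨g, hg⟩ := exists_lift (enum _ hc) (w₀⁻¹ * w) (fun x hx => by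
      rw [hr, not_not] at hx
      have h1 := (le_iff a w₀).1 h₀.1 x hx
      rw [(le_iff a w).1 hw.1 x hx, Option.some_inj] at h1
      rw [Perm.mul_apply, Perm.inv_eq_iff_eq, h1])
    refine ⟨⟨g, fun x => ?_⟩, Subtype.ext ?_⟩
    · have h1 : ((enum _ hc) x.1) ∉ a.dom := (hr _).1 ⟨_, rfl⟩
      have h2 : PreservesPair (w₀⁻¹ * w) (enum _ hc x.1, x.2) := by
        refine PreservesPair.mul ?_ (hw.2 _ h1)
        have h3 : (w (enum _ hc x.1, x.2)).1 ∉ a.cod := by rwa [mem_cod_iff hw.1]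
        rw [← perm_apply_inv_self w₀ (w _), preservesPair_inv]
        apply h₀.2
        rwa [mem_cod_iff' h₀.1]
      rw [← hg, PreservesPair, swap_embed, lift_apply, lift_apply, swap_embed, embed_inj] at h2
      exact h2
    · simp only [hg, mul_inv_cancel_left]

end PartialBij

/-! ### Coset-types, trivial extensions and restrictions -/

section Types

/-- The multiplicity of `1` is what the other parts leave of the sum, so a type that ignores `1`
loses nothing once the size is known. -/
theorem multiset_eq_of_count {A B : Multiset ℕ} (hs : A.sum = B.sum)
    (h : ∀ j, j ≠ 1 → A.count j = B.count j) : A = B := by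
  have key : ∀ C : Multiset ℕ, C.sum = C.count 1 + (C.filter (· ≠ 1)).sum := fun C => by
    conv_lhs => rw [← Multiset.filter_add_not (· = 1) C]
    rw [Multiset.sum_add, Multiset.filter_eq', Multiset.sum_replicate, smul_eq_mul, mul_one]
  have hf : A.filter (· ≠ 1) = B.filter (· ≠ 1) := by
    ext j
    rw [Multiset.count_filter, Multiset.count_filter]
    split_ifs with hj
    · exact h j hj
    · rfl
  ext j
  by_cases hj : j = 1
  · subst hj
    have := key A
    rw [hs, key B, hf] at this
    omega
  · exact h j hj

variable {n : ℕ}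

theorem stat_eq_card (v : Perm (Pt n)) (d : Finset (Fin n)) (j : ℕ) :
    stat v d j = (Finset.univ.filter fun x : Pt n => x.1 ∈ d ∧ minimalPeriod v x = j).card := by
  rw [stat, Nat.card_eq_fintype_card, Fintype.card_subtype]

theorem sum_stat (v : Perm (Pt n)) (d : Finset (Fin n)) {t : Finset ℕ}
    (ht : ∀ x, minimalPeriod v x ∈ t) : ∑ j ∈ t, stat v d j = d.card * 2 := by
  rw [← PartialBij.card_over, Nat.card_eq_fintype_card, Fintype.card_subtype,
    Finset.card_eq_sum_card_fiberwise (f := minimalPeriod v) (t := t) fun x _ => ht x]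
  simp only [stat_eq_card, Finset.filter_filter]

theorem stat_union (v : Perm (Pt n)) {d d' : Finset (Fin n)} (h : Disjoint d d') (j : ℕ) :
    stat v (d ∪ d') j = stat v d j + stat v d' j := by
  rw [stat_eq_card, stat_eq_card, stat_eq_card, ← Finset.card_union_of_disjoint]
  · congr 1
    ext x
    simp only [Finset.mem_filter, Finset.mem_union, Finset.mem_univ, true_and]
    tauto
  · rw [Finset.disjoint_left] at h ⊢
    intro x hx hx'
    simp only [Finset.mem_filter] at hx hx'
    exact h hx.2.1 hx'.2.1

theorem fixed_of_stat_one {v : Perm (Pt n)} {d : Finset (Fin n)} (h : stat v d 1 = d.card * 2)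
    {x : Pt n} (hx : x.1 ∈ d) : v x = x := by
  rw [← PartialBij.card_over, stat_eq_card, Nat.card_eq_fintype_card, Fintype.card_subtype] at h
  have := Finset.eq_of_subset_of_card_le (s := Finset.univ.filter fun x : Pt n =>
    x.1 ∈ d ∧ minimalPeriod v x = 1) (t := Finset.univ.filter fun x : Pt n => x.1 ∈ d)
    (fun x hx => by simp only [Finset.mem_filter] at hx ⊢; exact ⟨hx.1, hx.2.1⟩) h.ge
  have hx' : x ∈ Finset.univ.filter fun x : Pt n => x.1 ∈ d := by simpa using hx
  rw [← this, Finset.mem_filter] at hx'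
  exact minimalPeriod_eq_one.1 hx'.2.2

theorem stat_eq_of_fixed {v : Perm (Pt n)} {d : Finset (Fin n)}
    (h : ∀ x : Pt n, x.1 ∉ d → v x = x) {j : ℕ} (hj : 2 ≤ j) :
    stat v Finset.univ j = stat v d j := by
  rw [stat_eq_card, stat_eq_card]
  congr 1
  ext x
  simp only [Finset.mem_filter, Finset.mem_univ, true_and]
  refine ⟨fun hx => ⟨by_contra fun hd => ?_, hx⟩, And.right⟩
  have := minimalPeriod_eq_one.2 (h x hd)
  omega

/-- The partial bijection given by a permutation. -/
def PartialBij.ofPerm (w : Perm (Pt n)) : PartialBij n where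
  map := w.toPEquiv
  dom_pairs _ := rfl
  cod_pairs _ := rfl

@[simp] theorem PartialBij.dom_ofPerm (w : Perm (Pt n)) : (ofPerm w).dom = Finset.univ := by
  ext i
  simp [dom, ofPerm]

theorem PartialBij.extends_ofPerm (w : Perm (Pt n)) : Extends (ofPerm w) w :=
  ⟨le_rfl, fun x hx => absurd (by simp) hx⟩

namespace PartialBij

variable {a a' : PartialBij n} {w : Perm (Pt n)}

theorem cosetType_sum (a : PartialBij n) : (cosetType a.map).sum = a.dom.card := by
  obtain ⟨w, hw⟩ := a.exists_extends
  -- `t` must contain all periods, to count every point over the domain, and all parts, to sum the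
  -- coset-type.
  let t := (Finset.univ.image (minimalPeriod (twist w))) ∪ (cosetType a.map).toFinset
  have h1 := sum_stat (twist w) a.dom (t := t) fun x =>
    Finset.mem_union_left _ (Finset.mem_image_of_mem _ (Finset.mem_univ x))
  rw [Finset.sum_multiset_count_of_subset _ t Finset.subset_union_right]
  rw [Finset.sum_congr rfl fun j _ => count_cosetType hw.1 j] at h1
  apply Nat.eq_of_mul_eq_mul_right two_pos
  rw [← h1, Finset.sum_mul]
  refine Finset.sum_congr rfl fun j _ => ?_
  rw [smul_eq_mul]
  ring

theorem Extends.twist_eq (h : Extends a w) {x : Pt n} (hx : x.1 ∉ a.dom) : twist w x = x :=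
  (preservesPair_iff w x).1 (h.2 x hx)

/-- Outside the domain `twist w` is the identity, so parts `≥ 2` are visible on all of `[2n]`; the
number of parts `1` is then fixed by the size of the domain. -/
theorem cosetType_eq_iff (h : Extends a w) {q : Multiset ℕ} (hq : ∀ j ∈ q, 0 < j) :
    cosetType a.map = q ↔ q.sum = a.dom.card ∧ HasType (twist w) q := by
  constructor
  · rintro rfl
    exact ⟨cosetType_sum a, fun j hj => by
      rw [stat_eq_of_fixed (fun x hx => h.twist_eq hx) hj, count_cosetType h.1]⟩
  · rintro ⟨h1, h2⟩
    refine multiset_eq_of_count ((cosetType_sum a).trans h1.symm) fun j hj => ?_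
    rcases Nat.eq_zero_or_pos j with rfl | hj0
    · rw [Multiset.count_eq_zero.2 fun h0 => (pos_of_mem_cosetType h.1 h0).ne' rfl,
        Multiset.count_eq_zero.2 fun h0 => (hq 0 h0).ne' rfl]
    · have h3 := h2 j (by omega)
      rw [stat_eq_of_fixed (fun x hx => h.twist_eq hx) (by omega), count_cosetType h.1] at h3
      exact Nat.eq_of_mul_eq_mul_right (by omega) h3

theorem cosetType_eq_parts_iff (h : Extends a w) {k : ℕ} (p : k.Partition) :
    cosetType a.map = p.parts ↔ a.dom.card = k ∧ HasType (twist w) p.parts := by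
  rw [cosetType_eq_iff h fun j hj => p.parts_pos hj, p.parts_sum, eq_comm]

theorem cosetType_perm_iff (w : Perm (Pt n)) {k : ℕ} (hk : k ≤ n) (p : k.Partition) :
    cosetType w.toPEquiv = p.parts + Multiset.replicate (n - k) 1 ↔
      HasType (twist w) p.parts := by
  have := cosetType_eq_iff (extends_ofPerm w) (q := p.parts + Multiset.replicate (n - k) 1) (by
    intro j hj
    rcases Multiset.mem_add.1 hj with h | h
    · exact p.parts_pos h
    · rw [Multiset.eq_of_mem_replicate h]; exact one_pos)
  rw [show cosetType w.toPEquiv = cosetType (ofPerm w).map from rfl, this]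
  simp only [Multiset.sum_add, p.parts_sum, Multiset.sum_replicate, smul_eq_mul, mul_one,
    dom_ofPerm, Finset.card_univ, Fintype.card_fin, Nat.add_sub_cancel' hk, true_and]
  refine forall₂_congr fun j hj => ?_
  rw [Multiset.count_add, Multiset.count_replicate, if_neg (by omega), add_zero]

theorem exists_partition (a : PartialBij n) : ∃ p : a.dom.card.Partition,
    cosetType a.map = p.parts := by
  obtain ⟨w, hw⟩ := a.exists_extends
  exact ⟨⟨cosetType a.map, fun hj => pos_of_mem_cosetType hw.1 hj, cosetType_sum a⟩, rfl⟩

theorem dom_subset (h : a.map ≤ a'.map) : a.dom ⊆ a'.dom := fun i hi => by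
  rw [← isSome_map_iff a (i, false)] at hi
  rw [← isSome_map_iff a' (i, false)]
  obtain ⟨y, hy⟩ := Option.isSome_iff_exists.1 hi
  exact Option.isSome_iff_exists.2 ⟨y, h _ _ hy⟩

/-- The added parts `1` are exactly as many as the added pairs, so each added pair must be a
two-vertex cycle, that is, be preserved. Under a fixed permutation, trivial extensions thus become
enlargements of the domain. -/
theorem isTrivialExtension_iff (h : Extends a' w) :
    IsTrivialExtension a a' ↔ Extends a w ∧ a.dom ⊆ a'.dom := by
  constructor
  · rintro ⟨hle, hct⟩
    have hd := dom_subset hle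
    have hw : a.map ≤ w.toPEquiv := hle.trans h.1
    refine ⟨⟨hw, fun x hx => ?_⟩, hd⟩
    by_cases hx' : x.1 ∈ a'.dom
    · have h1 := count_cosetType h.1 1
      rw [hct, Multiset.count_add, Multiset.count_replicate_self, add_mul,
        ← count_cosetType hw, ← Finset.union_sdiff_of_subset hd,
        stat_union _ Finset.disjoint_sdiff] at h1
      rw [Finset.union_sdiff_of_subset hd, mul_one] at h1
      rw [preservesPair_iff]
      -- After cancelling the points over `a.dom`, all points over the added pairs are counted with
      -- period `1`.
      exact fixed_of_stat_one (Nat.add_left_cancel h1) (Finset.mem_sdiff.2 ⟨hx', hx⟩)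
    · exact h.2 x hx'
  · rintro ⟨hw, hd⟩
    refine ⟨fun x y hy => ?_, ?_⟩
    · have hx := (isSome_map_iff a x).1 (Option.isSome_iff_exists.2 ⟨y, hy⟩)
      have h1 := (le_iff a w).1 hw.1 x hx
      have h2 := (le_iff a' w).1 h.1 x (hd hx)
      rw [h1] at hy
      rw [h2]
      exact hy
    · rw [cosetType_eq_iff h]
      · refine ⟨?_, fun j hj => ?_⟩
        · rw [Multiset.sum_add, cosetType_sum, Multiset.sum_replicate, smul_eq_mul, mul_one,
            add_comm, Finset.card_sdiff_add_card_eq_card hd]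
        · rw [Multiset.count_add, Multiset.count_replicate, if_neg (by omega), add_zero,
            ← count_cosetType hw.1, stat_eq_of_fixed (fun x hx => hw.twist_eq hx) hj]
      · intro j hj
        rcases Multiset.mem_add.1 hj with h' | h'
        · exact pos_of_mem_cosetType hw.1 h'
        · rw [Multiset.eq_of_mem_replicate h']; exact one_pos

theorem ext_of_le (h : a.map ≤ w.toPEquiv) (h' : a'.map ≤ w.toPEquiv) (hd : a.dom = a'.dom) :
    a = a' := by
  apply map_injective
  ext1 x
  by_cases hx : x.1 ∈ a.dom
  · rw [(le_iff a w).1 h x hx, (le_iff a' w).1 h' x (hd ▸ hx)]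
  · have h1 := hx
    rw [← isSome_map_iff, Bool.not_eq_true, Option.isSome_eq_false_iff] at h1
    rw [hd, ← isSome_map_iff, Bool.not_eq_true, Option.isSome_eq_false_iff] at hx
    rw [Option.isNone_iff_eq_none.1 h1, Option.isNone_iff_eq_none.1 hx]

/-- The restriction of a permutation that maps the pairs outside `e` to pairs. -/
theorem exists_restrict (w : Perm (Pt n)) (e : Finset (Fin n))
    (h : ∀ x : Pt n, x.1 ∉ e → PreservesPair w x) :
    ∃ a : PartialBij n, a.dom = e ∧ Extends a w := by
  classical
  let f : Pt n ≃. Pt n := (PEquiv.ofSet {x : Pt n | x.1 ∈ e}).trans w.toPEquiv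
  have hf : ∀ x y, y ∈ f x ↔ x.1 ∈ e ∧ y = w x := fun x y => by
    simp only [f, PEquiv.mem_trans, PEquiv.mem_ofSet_iff, Equiv.toPEquiv_apply,
      Option.mem_some_iff, Set.mem_ofPred_eq]
    constructor
    · rintro ⟨_, ⟨rfl, h1⟩, rfl⟩
      exact ⟨h1, rfl⟩
    · rintro ⟨h1, rfl⟩
      exact ⟨x, ⟨rfl, h1⟩, rfl⟩
  have hs : ∀ x, (f x).isSome ↔ x.1 ∈ e := fun x => by
    rw [Option.isSome_iff_exists]
    exact ⟨fun ⟨y, hy⟩ => ((hf x y).1 hy).1, fun hx => ⟨w x, (hf x _).2 ⟨hx, rfl⟩⟩⟩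
  have hs' : ∀ y, (f.symm y).isSome ↔ (w⁻¹ y).1 ∈ e := fun y => by
    rw [Option.isSome_iff_exists]
    constructor
    · rintro ⟨x, hx⟩
      obtain ⟨h1, rfl⟩ := (hf x y).1 ((PEquiv.mem_iff_mem f).1 hx)
      rwa [perm_inv_apply_self]
    · intro hy
      exact ⟨w⁻¹ y, (PEquiv.mem_iff_mem f).2 ((hf _ _).2 ⟨hy, (perm_apply_inv_self w y).symm⟩)⟩
  -- The complement of the image of `e` is a union of pairs because `w` preserves the pairs outside
  -- `e`; hence so is the image itself.
  have hcod : ∀ y : Pt n, (w⁻¹ y).1 ∉ e → (w⁻¹ (swap n y)).1 ∉ e := fun y hy => by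
    have h1 := h _ hy
    rw [PreservesPair, perm_apply_inv_self, ← Perm.eq_inv_iff_eq] at h1
    rw [← h1]
    exact hy
  let a : PartialBij n :=
    { map := f
      dom_pairs := fun i => by rw [Bool.eq_iff_iff, hs, hs]
      cod_pairs := fun i => by
        rw [Bool.eq_iff_iff, hs', hs']
        exact not_iff_not.1 ⟨hcod (i, false), hcod (i, true)⟩ }
  have hd : a.dom = e := by
    ext i
    rw [← isSome_map_iff a (i, false)]
    exact hs _
  refine ⟨a, hd, (le_iff a w).2 fun x hx => (hf x _).2 ⟨hd ▸ hx, rfl⟩, fun x hx => h x ?_⟩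
  rwa [← hd]

theorem comp_extends {a b : PartialBij n} (h : a.dom = b.cod) {w₁ w₂ : Perm (Pt n)}
    (h₁ : Extends a w₁) (h₂ : Extends b w₂) :
    (a.comp b h).dom = b.dom ∧ Extends (a.comp b h) (w₁ * w₂) := by
  have hd : (a.comp b h).dom = b.dom := by
    ext i
    rw [← isSome_map_iff _ (i, false), ← isSome_map_iff b (i, false)]
    have := isSome_trans b.map a.map (fun y hy => by
      rw [isSome_map_iff, h, ← isSome_symm_iff]; exact hy) (i, false)
    exact Bool.eq_iff_iff.1 this
  refine ⟨hd, (le_iff _ _).2 fun x hx => ?_, fun x hx => ?_⟩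
  · rw [hd] at hx
    refine (PEquiv.mem_trans b.map a.map x _).2 ⟨w₂ x, (le_iff b w₂).1 h₂.1 x hx, ?_⟩
    refine (le_iff a w₁).1 h₁.1 _ ?_
    rwa [h, mem_cod_iff h₂.1]
  · rw [hd] at hx
    refine PreservesPair.mul (h₁.2 _ ?_) (h₂.2 x hx)
    rwa [h, mem_cod_iff h₂.1]

end PartialBij
end Types

/-! ### The product of partial bijections as a count of pairs of permutations -/

variable {n : ℕ}

open Classical in
/-- The indices of the pairs that are not mapped to pairs. -/
noncomputable def brokenPairs (w : Perm (Pt n)) : Finset (Fin n) :=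
  {i | ¬ PreservesPair w (i, false)}

theorem mem_brokenPairs {w : Perm (Pt n)} {x : Pt n} :
    x.1 ∈ brokenPairs w ↔ ¬ PreservesPair w x := by
  rw [← preservesPair_congr (x := (x.1, false)) (y := x) rfl]
  simp [brokenPairs]

/-- The number of trivial extensions to `[2n]` of a partial bijection of `k` pairs. -/
def extCount (n k : ℕ) : ℕ := 2 ^ (n - k) * (n - k).factorial

theorem extCount_pos (n k : ℕ) : 0 < extCount n k := by
  unfold extCount; positivity

namespace PartialBij

/-- The inverse of a partial bijection. -/
def symm (a : PartialBij n) : PartialBij n where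
  map := a.map.symm
  dom_pairs := a.cod_pairs
  cod_pairs := a.dom_pairs

theorem dom_symm (a : PartialBij n) : a.symm.dom = a.cod := rfl

theorem cod_symm (a : PartialBij n) : a.symm.cod = a.dom := rfl

theorem Extends.symm {a : PartialBij n} {w : Perm (Pt n)} (h : Extends a w) :
    Extends a.symm w⁻¹ := by
  refine ⟨(le_iff _ _).2 fun x hx => ?_, fun x hx => ?_⟩
  · rw [dom_symm, ← mem_cod_iff' h.1] at hx
    have := (le_iff a w).1 h.1 _ hx
    rw [perm_apply_inv_self] at this
    exact (PEquiv.mem_iff_mem a.map).2 this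
  · rw [dom_symm, ← mem_cod_iff' h.1] at hx
    have := preservesPair_inv.2 (h.2 _ hx)
    rwa [perm_apply_inv_self] at this

theorem exists_corestrict (w : Perm (Pt n)) (e : Finset (Fin n))
    (h : ∀ x : Pt n, x.1 ∉ e → PreservesPair w⁻¹ x) :
    ∃ a : PartialBij n, a.cod = e ∧ Extends a w := by
  obtain ⟨a, rfl, ha⟩ := exists_restrict w⁻¹ e h
  exact ⟨a.symm, a.cod_symm, ha.symm⟩

theorem ext_of_cod {a a' : PartialBij n} {w : Perm (Pt n)} (h : a.map ≤ w.toPEquiv)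
    (h' : a'.map ≤ w.toPEquiv) (hd : a.cod = a'.cod) : a = a' := by
  refine ext_of_le h h' ?_
  ext i
  rw [← mem_cod_iff h (i, false), ← mem_cod_iff h' (i, false), hd]

/-- Without parts `1` no pair of the domain is preserved, so the domain, and with it `a`, is
recovered from `w`. Properness of the partitions enters through this. -/
theorem dom_eq_brokenPairs {a : PartialBij n} {w : Perm (Pt n)} (h : Extends a w)
    (h1 : 1 ∉ cosetType a.map) : a.dom = brokenPairs w := by
  ext i
  rw [mem_brokenPairs (x := (i, false))]
  refine ⟨fun hi hp => ?_, fun hp => by_contra fun hi => hp (h.2 (i, false) hi)⟩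
  have h2 := count_cosetType h.1 1
  rw [Multiset.count_eq_zero.2 h1, zero_mul, stat, Nat.card_eq_zero] at h2
  obtain h2 | h2 := h2
  · exact h2.false ⟨(i, false), hi, minimalPeriod_eq_one.2 ((preservesPair_iff _ _).1 hp)⟩
  · exact h2.not_finite inferInstance

theorem cod_eq_brokenPairs {a : PartialBij n} {w : Perm (Pt n)} (h : Extends a w)
    (h1 : 1 ∉ cosetType a.map) : a.cod = brokenPairs w⁻¹ := by
  ext i
  rw [mem_brokenPairs (x := (i, false)), ← perm_apply_inv_self w (i, false), preservesPair_inv,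
    ← mem_brokenPairs, ← dom_eq_brokenPairs h h1, mem_cod_iff' h.1]

theorem exists_extends_of_hasType {w : Perm (Pt n)} {k : ℕ} (hk : k ≤ n) {p : k.Partition}
    (hp : IsProper p) (hw : HasType (twist w) p.parts) :
    ∃ a : PartialBij n, cosetType a.map = p.parts ∧ Extends a w := by
  obtain ⟨a, hd, ha⟩ := exists_restrict w (brokenPairs w)
    fun x hx => by rwa [mem_brokenPairs, not_not] at hx
  refine ⟨a, ?_, ha⟩
  have h1 := ((isTrivialExtension_iff (extends_ofPerm w)).2
    ⟨ha, by rw [dom_ofPerm]; exact Finset.subset_univ _⟩).2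
  have h2 := (cosetType_perm_iff w hk p).2 hw
  rw [show cosetType (ofPerm w).map = cosetType w.toPEquiv from rfl, h2] at h1
  have h3 : (cosetType a.map).count 1 = 0 := by
    have h4 := count_cosetType ha.1 1
    have h5 : stat (twist w) a.dom 1 = 0 := by
      rw [stat, Nat.card_eq_zero]
      refine Or.inl ⟨fun x => ?_⟩
      have h6 : x.1.1 ∈ brokenPairs w := hd ▸ x.2.1
      rw [mem_brokenPairs, preservesPair_iff] at h6
      exact h6 (minimalPeriod_eq_one.1 x.2.2)
    omega
  have h7 : p.parts.count 1 = 0 := Multiset.count_eq_zero.2 hp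
  -- Neither `cosetType a.map` nor `p.parts` contains `1`, so the two blocks of added ones have
  -- equal length and cancel.
  have h8 := congrArg (Multiset.count 1) h1
  rw [Multiset.count_add, Multiset.count_add, h3, h7, Multiset.count_replicate_self,
    Multiset.count_replicate_self, zero_add, zero_add] at h8
  rw [h8] at h1
  exact (add_right_cancel h1).symm

/-- `a` is the restriction of `w₁ * w₂` to the preimage of `e` under `w₂`. -/
def IsProductOver (a : PartialBij n) (e : Finset (Fin n)) (w₁ w₂ : Perm (Pt n)) : Prop :=
  a.map ≤ (w₁ * w₂).toPEquiv ∧ ∀ x : Pt n, x.1 ∈ a.dom ↔ (w₂ x).1 ∈ e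

theorem mem_E {a₁ a₂ : PartialBij n} {p : PartialBij n × PartialBij n} : p ∈ E a₁ a₂ ↔
    IsTrivialExtension a₁ p.1 ∧ IsTrivialExtension a₂ p.2 ∧
      p.1.dom = a₁.dom ∪ a₂.cod ∧ p.2.cod = a₁.dom ∪ a₂.cod := by
  simp [E]

/-- Pairs of extensions to permutations factor uniformly through the set `E a₁ a₂`. -/
theorem card_extends_pairs (a₁ a₂ : PartialBij n) (P : Perm (Pt n) × Perm (Pt n) → Prop)
    (P' : {p // p ∈ E a₁ a₂} → Prop)
    (hP : ∀ p : {p // p ∈ E a₁ a₂}, ∀ w₁ w₂, Extends p.1.1 w₁ → Extends p.1.2 w₂ →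
      (P (w₁, w₂) ↔ P' p)) :
    Nat.card {w : Perm (Pt n) × Perm (Pt n) // Extends a₁ w.1 ∧ Extends a₂ w.2 ∧ P w} =
      Nat.card {p : {p // p ∈ E a₁ a₂} // P' p} *
        (extCount n (a₁.dom ∪ a₂.cod).card * extCount n (a₁.dom ∪ a₂.cod).card) := by
  classical
  -- Both members of a pair in `E a₁ a₂` have domains of the size of `a₁.dom ∪ a₂.cod`, so all
  -- fibres are equally large.
  have hfib : ∀ p : {p : {p // p ∈ E a₁ a₂} // P' p},
      Nat.card ({w₁ // Extends p.1.1.1 w₁} × {w₂ // Extends p.1.1.2 w₂}) =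
        extCount n (a₁.dom ∪ a₂.cod).card * extCount n (a₁.dom ∪ a₂.cod).card := fun p => by
    have hp := mem_E.1 p.1.2
    rw [Nat.card_prod, card_extends, card_extends, ← card_cod p.1.1.2, hp.2.2.1, hp.2.2.2]
    rfl
  have hsig : Nat.card (Σ p : {p : {p // p ∈ E a₁ a₂} // P' p},
      {w₁ // Extends p.1.1.1 w₁} × {w₂ // Extends p.1.1.2 w₂}) =
      Nat.card {p : {p // p ∈ E a₁ a₂} // P' p} *
        (extCount n (a₁.dom ∪ a₂.cod).card * extCount n (a₁.dom ∪ a₂.cod).card) := by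
    rw [Nat.card_sigma, Fintype.sum_congr _ _ hfib, Finset.sum_const, Finset.card_univ,
      smul_eq_mul, Nat.card_eq_fintype_card]
  rw [← hsig]
  symm
  refine Nat.card_eq_of_bijective (fun q => ⟨(q.2.1.1, q.2.2.1), ?_, ?_, ?_⟩) ⟨?_, ?_⟩
  · exact ((isTrivialExtension_iff q.2.1.2).1 (mem_E.1 q.1.1.2).1).1
  · exact ((isTrivialExtension_iff q.2.2.2).1 (mem_E.1 q.1.1.2).2.1).1
  · exact (hP _ _ _ q.2.1.2 q.2.2.2).2 q.1.2
  · rintro ⟨⟨⟨⟨b₁, b₂⟩, hb⟩, hb'⟩, ⟨w₁, h₁⟩, ⟨w₂, h₂⟩⟩ ⟨⟨⟨⟨c₁, c₂⟩, hc⟩, hc'⟩, ⟨v₁, k₁⟩, ⟨v₂, k₂⟩⟩ h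
    have h' := congrArg Subtype.val h
    simp only [Prod.mk.injEq] at h'
    obtain ⟨rfl, rfl⟩ := h'
    have e1 : b₁ = c₁ := ext_of_le h₁.1 k₁.1 ((mem_E.1 hb).2.2.1.trans (mem_E.1 hc).2.2.1.symm)
    have e2 : b₂ = c₂ := ext_of_cod h₂.1 k₂.1
      ((mem_E.1 hb).2.2.2.trans (mem_E.1 hc).2.2.2.symm)
    subst e1 e2
    rfl
  · rintro ⟨⟨w₁, w₂⟩, h₁, h₂, hw⟩
    obtain ⟨b₁, hd, hb₁⟩ := exists_restrict w₁ (a₁.dom ∪ a₂.cod) fun x hx =>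
      h₁.2 x fun hx' => hx (Finset.mem_union_left _ hx')
    obtain ⟨b₂, hc, hb₂⟩ := exists_corestrict w₂ (a₁.dom ∪ a₂.cod) fun x hx =>
      h₂.symm.2 x fun hx' => hx (Finset.mem_union_right _ hx')
    have hE : (b₁, b₂) ∈ E a₁ a₂ := by
      refine mem_E.2 ⟨(isTrivialExtension_iff hb₁).2 ⟨h₁, hd ▸ Finset.subset_union_left⟩,
        (isTrivialExtension_iff hb₂).2 ⟨h₂, fun i hi => ?_⟩, hd, hc⟩
      rw [← mem_cod_iff hb₂.1 (i, false), hc]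
      exact Finset.mem_union_right _ ((mem_cod_iff h₂.1 (i, false)).2 hi)
    exact ⟨⟨⟨⟨(b₁, b₂), hE⟩, (hP ⟨(b₁, b₂), hE⟩ _ _ hb₁ hb₂).1 hw⟩, ⟨w₁, hb₁⟩, ⟨w₂, hb₂⟩⟩, rfl⟩

theorem isProductOver_iff {a b c : PartialBij n} (h : b.dom = c.cod) {w₁ w₂ : Perm (Pt n)}
    (h₁ : Extends b w₁) (h₂ : Extends c w₂) :
    IsProductOver a c.cod w₁ w₂ ↔ b.comp c h = a := by
  obtain ⟨hd, hw⟩ := comp_extends h h₁ h₂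
  constructor
  · rintro ⟨hle, hdom⟩
    refine ext_of_le hw.1 hle ?_
    ext i
    rw [hd, hdom (i, false), mem_cod_iff h₂.1]
  · rintro rfl
    exact ⟨hw.1, fun x => by rw [hd, mem_cod_iff h₂.1]⟩

/-- Replacing each pair in `E a₁ a₂` by its extensions to permutations multiplies the numerator and
the denominator of the average by the same number; the denominator becomes the number of all pairs
of extensions of `a₁` and `a₂`. -/
theorem basisMul_apply (a₁ a₂ a : PartialBij n) :
    (extCount n a₁.dom.card * extCount n a₂.dom.card : ℂ) * D.basisMul a₁ a₂ a =
      Nat.card {w : Perm (Pt n) × Perm (Pt n) // Extends a₁ w.1 ∧ Extends a₂ w.2 ∧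
        IsProductOver a (a₁.dom ∪ a₂.cod) w.1 w.2} := by
  classical
  have h1 := card_extends_pairs a₁ a₂ (fun w => IsProductOver a (a₁.dom ∪ a₂.cod) w.1 w.2)
    (fun p => p.1.1.comp p.1.2 (dom_eq_cod_of_mem_E p.2) = a) (fun p w₁ w₂ h₁ h₂ => by
      rw [← isProductOver_iff _ h₁ h₂, (mem_E.1 p.2).2.2.2])
  have h2 := card_extends_pairs a₁ a₂ (fun _ => True) (fun _ => True) (fun p w₁ w₂ h₁ h₂ => Iff.rfl)
  have h3 : Nat.card {w : Perm (Pt n) × Perm (Pt n) //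
      Extends a₁ w.1 ∧ Extends a₂ w.2 ∧ True} =
      extCount n a₁.dom.card * extCount n a₂.dom.card := by
    rw [extCount, extCount, ← card_extends, ← card_extends, ← Nat.card_prod]
    exact Nat.card_congr
      { toFun := fun w => (⟨w.1.1, w.2.1⟩, ⟨w.1.2, w.2.2.1⟩)
        invFun := fun w => ⟨(w.1.1, w.2.1), w.1.2, w.2.2, trivial⟩
        left_inv := fun _ => rfl
        right_inv := fun _ => rfl }
  have h4 : Nat.card {p : {p // p ∈ E a₁ a₂} // True} = (E a₁ a₂).card := by
    rw [Nat.card_eq_fintype_card, Fintype.card_subtype]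
    simp
  have h5 : D.basisMul a₁ a₂ a = ((E a₁ a₂).card : ℂ)⁻¹ *
      Nat.card {p : {p // p ∈ E a₁ a₂} //
        p.1.1.comp p.1.2 (dom_eq_cod_of_mem_E p.2) = a} := by
    rw [D.basisMul, Finsupp.smul_apply, Finsupp.finsetSum_apply, smul_eq_mul,
      Nat.card_eq_fintype_card, Fintype.card_subtype, Finset.card_filter]
    congr 1
    push_cast
    refine Finset.sum_congr rfl fun p _ => ?_
    rw [Finsupp.single_apply]
  rw [h4, h3] at h2
  -- `E a₁ a₂` is nonempty since extensions to permutations exist, so the inverse in the average is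
  -- genuine.
  have h6 : (E a₁ a₂).card ≠ 0 := fun h0 => by
    rw [h0, zero_mul] at h2
    exact (Nat.mul_pos (extCount_pos _ _) (extCount_pos _ _)).ne' h2
  have h7 : ((E a₁ a₂).card : ℂ) ≠ 0 := by exact_mod_cast h6
  rw [h1, h5, ← Nat.cast_mul, h2]
  push_cast
  field_simp

end PartialBij

theorem S_apply {k : ℕ} (p : k.Partition) (a : PartialBij n) :
    open Classical in S n p a = if cosetType a.map = p.parts then 1 else 0 := by
  classical
  rw [S, Finsupp.finsetSum_apply, Finset.sum_filter]
  simp only [Finsupp.single_apply]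
  rw [Finset.sum_eq_single a]
  · simp
  · intro b _ hb
    simp [hb]
  · simp

theorem mul_S_apply {l d : ℕ} (lam : l.Partition) (del : d.Partition) (a : PartialBij n) :
    open Classical in D.mul (S n lam) (S n del) a =
      ∑ a₁ : PartialBij n with cosetType a₁.map = lam.parts,
        ∑ a₂ : PartialBij n with cosetType a₂.map = del.parts, D.basisMul a₁ a₂ a := by
  classical
  rw [D.mul, Finsupp.sum_fintype _ _ (by simp)]
  rw [Finsupp.finsetSum_apply, Finset.sum_filter]
  refine Finset.sum_congr rfl fun a₁ _ => ?_
  rw [Finsupp.sum_fintype _ _ (by simp), Finsupp.finsetSum_apply, Finset.sum_filter]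
  split_ifs with h
  · refine Finset.sum_congr rfl fun a₂ _ => ?_
    rw [S_apply, S_apply, if_pos h, one_mul, Finsupp.smul_apply]
    split_ifs <;> simp
  · refine Finset.sum_eq_zero fun a₂ _ => ?_
    rw [S_apply, if_neg h, zero_mul, zero_smul, Finsupp.zero_apply]

open PartialBij in
/-- The coefficients of the product of `S n lam` and `S n del` count pairs of permutations. -/
theorem extCount_mul_mul_S_apply {l d : ℕ} {lam : l.Partition} {del : d.Partition}
    (hlam : IsProper lam) (hdel : IsProper del) (hl : l ≤ n) (hd : d ≤ n) (a : PartialBij n) :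
    (extCount n l * extCount n d : ℂ) * D.mul (S n lam) (S n del) a =
      Nat.card {w : Perm (Pt n) × Perm (Pt n) // HasType (twist w.1) lam.parts ∧
        HasType (twist w.2) del.parts ∧
        IsProductOver a (brokenPairs w.1 ∪ brokenPairs w.2⁻¹) w.1 w.2} := by
  classical
  have hty : ∀ {k : ℕ} {p : k.Partition} {b : PartialBij n}, cosetType b.map = p.parts →
      b.dom.card = k := fun {k p b} h => by rw [← cosetType_sum, h, p.parts_sum]
  let Λ := {a₁ : PartialBij n // cosetType a₁.map = lam.parts}
  let Δ := {a₂ : PartialBij n // cosetType a₂.map = del.parts}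
  have h1 : (extCount n l * extCount n d : ℂ) * D.mul (S n lam) (S n del) a =
      ∑ q : Λ × Δ, (Nat.card {w : Perm (Pt n) × Perm (Pt n) // Extends q.1.1 w.1 ∧
        Extends q.2.1 w.2 ∧ IsProductOver a (q.1.1.dom ∪ q.2.1.cod) w.1 w.2} : ℂ) := by
    rw [mul_S_apply, Finset.mul_sum, Fintype.sum_prod_type]
    rw [← Finset.sum_subtype_eq_sum_filter, Finset.subtype_univ]
    refine Finset.sum_congr rfl fun a₁ _ => ?_
    rw [← Finset.sum_subtype_eq_sum_filter, Finset.subtype_univ, Finset.mul_sum]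
    refine Finset.sum_congr rfl fun a₂ _ => ?_
    rw [← basisMul_apply, hty a₁.2, hty a₂.2]
  rw [h1, ← Nat.cast_sum, ← Nat.card_sigma]
  congr 1
  have nl : ∀ q : Λ, 1 ∉ cosetType q.1.map := fun q => by rw [q.2]; exact hlam
  have nd : ∀ q : Δ, 1 ∉ cosetType q.1.map := fun q => by rw [q.2]; exact hdel
  -- By properness a pair `(w₁, w₂)` of the right types extends exactly one pair of partial
  -- bijections, whose relevant domain and codomain are the broken pairs of `w₁` and of `w₂⁻¹`.
  refine Nat.card_eq_of_bijective (fun q => ⟨q.2.1, ?_, ?_, ?_⟩) ⟨?_, ?_⟩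
  · exact ((cosetType_eq_parts_iff q.2.2.1 lam).1 q.1.1.2).2
  · exact ((cosetType_eq_parts_iff q.2.2.2.1 del).1 q.1.2.2).2
  · obtain ⟨q, w, h₁, h₂, h₃⟩ := q
    rwa [dom_eq_brokenPairs h₁ (nl _), cod_eq_brokenPairs h₂ (nd _)] at h₃
  · rintro ⟨⟨b₁, b₂⟩, w, h₁, h₂, h₃⟩ ⟨⟨c₁, c₂⟩, v, k₁, k₂, k₃⟩ h
    obtain rfl : w = v := congrArg Subtype.val h
    have e1 : b₁ = c₁ := Subtype.ext (ext_of_le h₁.1 k₁.1 (by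
      rw [dom_eq_brokenPairs h₁ (nl _), dom_eq_brokenPairs k₁ (nl _)]))
    have e2 : b₂ = c₂ := Subtype.ext (ext_of_le h₂.1 k₂.1 (by
      rw [dom_eq_brokenPairs h₂ (nd _), dom_eq_brokenPairs k₂ (nd _)]))
    subst e1 e2
    rfl
  · rintro ⟨w, h₁, h₂, h₃⟩
    obtain ⟨b₁, hb₁, he₁⟩ := exists_extends_of_hasType hl hlam h₁
    obtain ⟨b₂, hb₂, he₂⟩ := exists_extends_of_hasType hd hdel h₂
    refine ⟨⟨⟨⟨b₁, hb₁⟩, ⟨b₂, hb₂⟩⟩, ⟨w, he₁, he₂, ?_⟩⟩, rfl⟩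
    rwa [dom_eq_brokenPairs he₁ (nl ⟨b₁, hb₁⟩), cod_eq_brokenPairs he₂ (nd ⟨b₂, hb₂⟩)]

/-! ### Invariance under pair-preserving factors and existence of the expansions -/

section Invariance

variable {n : ℕ}

theorem stat_conj (v c : Perm (Pt n)) (j : ℕ) :
    stat (c⁻¹ * v * c) Finset.univ j = stat v Finset.univ j := by
  have hp : ∀ x, minimalPeriod (c⁻¹ * v * c) x = minimalPeriod v (c x) := fun x =>
    (minimalPeriod_of_semiconj c.injective (fun y => perm_apply_inv_self c (v (c y))) x).symm
  refine Nat.card_eq_of_bijective (fun x => ⟨c x.1, Finset.mem_univ _, (hp _).symm.trans x.2.2⟩)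
    ⟨fun x y h => ?_, fun y => ?_⟩
  · have := congrArg Subtype.val h
    exact Subtype.ext (c.injective this)
  · refine ⟨⟨c⁻¹ y.1, Finset.mem_univ _, ?_⟩, Subtype.ext (perm_apply_inv_self c y.1)⟩
    rw [hp, perm_apply_inv_self, y.2.2]

theorem stat_inv (v : Perm (Pt n)) (d : Finset (Fin n)) (j : ℕ) : stat v⁻¹ d j = stat v d j := by
  simp only [stat, minimalPeriod_inv]

theorem hasType_conj (v c : Perm (Pt n)) (p : Multiset ℕ) :
    HasType (c⁻¹ * v * c) p ↔ HasType v p :=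
  forall₂_congr fun j _ => by rw [stat_conj]

theorem hasType_inv (v : Perm (Pt n)) (p : Multiset ℕ) : HasType v⁻¹ p ↔ HasType v p :=
  forall₂_congr fun j _ => by rw [stat_inv]

theorem commute_of_preservesPair {g : Perm (Pt n)} (h : ∀ x, PreservesPair g x) :
    g * swap n = swap n * g := Equiv.ext h

/-- `g` commutes with `swap`, so the matching by preimages of pairs does not see it. With
`twist_mul_right` this makes the type an invariant of double cosets of the hyperoctahedral group. -/
theorem twist_mul_left {g : Perm (Pt n)} (h : ∀ x, PreservesPair g x) (w : Perm (Pt n)) :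
    twist (g * w) = twist w := by
  have e : g⁻¹ * swap n * g = swap n := by
    rw [mul_assoc, ← commute_of_preservesPair h, inv_mul_cancel_left]
  calc twist (g * w) = swap n * w⁻¹ * (g⁻¹ * swap n * g) * w := by rw [twist]; group
    _ = twist w := by rw [e]; rfl

theorem twist_mul_right {g : Perm (Pt n)} (h : ∀ x, PreservesPair g x) (w : Perm (Pt n)) :
    twist (w * g) = g⁻¹ * twist w * g := by
  have e : g⁻¹ * swap n = swap n * g⁻¹ := by
    rw [inv_mul_eq_iff_eq_mul, ← mul_assoc, commute_of_preservesPair h, mul_inv_cancel_right]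
  calc twist (w * g) = (swap n * g⁻¹) * w⁻¹ * swap n * w * g := by rw [twist]; group
    _ = g⁻¹ * twist w * g := by rw [← e, twist]; group

theorem preservesPair_inv_all {g : Perm (Pt n)} (h : ∀ x, PreservesPair g x) (x : Pt n) :
    PreservesPair g⁻¹ x := by
  rw [← perm_apply_inv_self g x, preservesPair_inv]
  exact h _

theorem brokenPairs_mul_left {g : Perm (Pt n)} (h : ∀ x, PreservesPair g x) (w : Perm (Pt n)) :
    brokenPairs (g * w) = brokenPairs w := by
  ext i
  rw [mem_brokenPairs (x := (i, false)), mem_brokenPairs (x := (i, false)), preservesPair_iff,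
    preservesPair_iff, twist_mul_left h]

namespace PartialBij

/-- Partial bijections of the same coset-type differ by permutations that preserve the pairs. -/
theorem exists_preservesPair_mul {a a' : PartialBij n} {w w' : Perm (Pt n)} (ha : Extends a w)
    (ha' : Extends a' w') (hct : cosetType a.map = cosetType a'.map) :
    ∃ g h : Perm (Pt n), (∀ x, PreservesPair g x) ∧ (∀ x, PreservesPair h x) ∧
      w' = g * w * h ∧ ∀ x : Pt n, x.1 ∈ a'.dom ↔ (h x).1 ∈ a.dom := by
  have hcard : a.dom.card = a'.dom.card := by rw [← cosetType_sum, hct, cosetType_sum]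
  -- The number of points with a given period inside or outside the domain depends only on the
  -- coset-type and the size of the domain; outside, every period is `1`.
  have hcount : ∀ {b : PartialBij n} {u : Perm (Pt n)} (_ : Extends b u) (j : ℕ) (c : Prop),
      Nat.card {x : Pt n // (minimalPeriod (twist u) x, x.1 ∈ b.dom) = (j, c)} =
        open Classical in if c then (cosetType b.map).count j * (2 * j) else
          if j = 1 then (n - b.dom.card) * 2 else 0 := fun {b u} hb j c => by
    by_cases hc : c
    · rw [if_pos hc, ← count_cosetType hb.1, stat]
      refine Nat.card_congr (Equiv.subtypeEquivRight fun x => ?_)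
      rw [Prod.mk.injEq, and_comm, eq_true hc, eq_iff_iff, iff_true]
    · rw [if_neg hc]
      have hiff : ∀ x : Pt n, (minimalPeriod (twist u) x, x.1 ∈ b.dom) = (j, c) ↔
          x.1 ∈ b.domᶜ ∧ j = 1 := fun x => by
        rw [Prod.mk.injEq, eq_false hc, eq_iff_iff, iff_false, Finset.mem_compl, and_comm]
        refine and_congr_right fun hx => ?_
        rw [minimalPeriod_eq_one.2 (hb.twist_eq hx), eq_comm]
      rw [Nat.card_congr (Equiv.subtypeEquivRight hiff)]
      split_ifs with hj
      · have hn : n - b.dom.card = b.domᶜ.card := by rw [Finset.card_compl, Fintype.card_fin]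
        rw [hn, ← card_over]
        exact Nat.card_congr (Equiv.subtypeEquivRight fun x => and_iff_left hj)
      · rw [Nat.card_eq_zero]
        exact Or.inl ⟨fun x => hj x.2.2⟩
  -- Colouring by membership in the domain makes the isomorphism carry domain to domain. That `φ`
  -- intertwines `swap` says that it preserves pairs; that it intertwines the twists says the same
  -- of `w' * φ * w⁻¹`.
  obtain ⟨φ, hs, hv, hχ⟩ := (isMatchingPair_twist w).exists_intertwining (isMatchingPair_twist w')
    (fun x => x.1 ∈ a.dom) (fun x => x.1 ∈ a'.dom)
    (fun x y hy => propext (mem_dom_iff_of_mem_pairOrbit ha.1 hy))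
    (fun x y hy => propext (mem_dom_iff_of_mem_pairOrbit ha'.1 hy))
    (fun j c => by rw [hcount ha, hcount ha', hct, hcard])
  have hφ : ∀ x, PreservesPair φ x := hs
  refine ⟨w' * φ * w⁻¹, φ⁻¹, fun x => ?_, preservesPair_inv_all hφ, by group, fun x => ?_⟩
  · have h1 := hv (w⁻¹ x)
    rw [twist_apply, twist_apply, perm_apply_inv_self, hs, (swap n).injective.eq_iff,
      Perm.eq_inv_iff_eq] at h1
    exact h1
  · rw [← hχ, perm_apply_inv_self]

/-- The substitution `(w₁, w₂) ↦ (g * w₁, w₂ * h)` injects one set into the other. The inequality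
suffices, since the hypothesis is symmetric in `a` and `a'`. -/
theorem card_isProductOver_le {a a' : PartialBij n} (hct : cosetType a.map = cosetType a'.map)
    (p q : Multiset ℕ) :
    Nat.card {w : Perm (Pt n) × Perm (Pt n) // HasType (twist w.1) p ∧ HasType (twist w.2) q ∧
        IsProductOver a (brokenPairs w.1 ∪ brokenPairs w.2⁻¹) w.1 w.2} ≤
      Nat.card {w : Perm (Pt n) × Perm (Pt n) // HasType (twist w.1) p ∧ HasType (twist w.2) q ∧
        IsProductOver a' (brokenPairs w.1 ∪ brokenPairs w.2⁻¹) w.1 w.2} := by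
  obtain ⟨w, hw⟩ := a.exists_extends
  obtain ⟨w', hw'⟩ := a'.exists_extends
  obtain ⟨g, h, hg, hh, rfl, hdom⟩ := exists_preservesPair_mul hw hw' hct
  refine Nat.card_le_card_of_injective
    (fun u => ⟨(g * u.1.1, u.1.2 * h), ?_, ?_, ?_, ?_⟩) fun u u' e => ?_
  · rw [twist_mul_left hg]
    exact u.2.1
  · rw [twist_mul_right hh, hasType_conj]
    exact u.2.2.1
  · obtain ⟨⟨u₁, u₂⟩, -, -, h1, h2⟩ := u
    refine (le_iff _ _).2 fun x hx => ?_
    have hx' := (hdom x).1 hx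
    have h3 := (le_iff _ _).1 h1 _ hx'
    rw [(le_iff _ _).1 hw.1 _ hx', Option.some_inj] at h3
    rw [(le_iff _ _).1 hw'.1 _ hx]
    exact congrArg (fun y => some (g y)) h3
  · obtain ⟨⟨u₁, u₂⟩, -, -, h1, h2⟩ := u
    intro x
    rw [hdom, h2, brokenPairs_mul_left hg, mul_inv_rev,
      brokenPairs_mul_left (preservesPair_inv_all hh)]
    rfl
  · have e' := congrArg Subtype.val e
    simp only [Prod.mk.injEq, mul_right_inj, mul_left_inj] at e'
    exact Subtype.ext (Prod.ext e'.1 e'.2)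

end PartialBij

theorem mul_S_congr {l d : ℕ} {lam : l.Partition} {del : d.Partition}
    (hlam : IsProper lam) (hdel : IsProper del) (hl : l ≤ n) (hd : d ≤ n) {a a' : PartialBij n}
    (hct : cosetType a.map = cosetType a'.map) :
    D.mul (S n lam) (S n del) a = D.mul (S n lam) (S n del) a' := by
  have h : (extCount n l * extCount n d : ℂ) ≠ 0 := by
    exact_mod_cast (Nat.mul_pos (extCount_pos n l) (extCount_pos n d)).ne'
  apply mul_left_cancel₀ h
  rw [extCount_mul_mul_S_apply hlam hdel hl hd, extCount_mul_mul_S_apply hlam hdel hl hd,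
    (PartialBij.card_isProductOver_le hct _ _).antisymm
      (PartialBij.card_isProductOver_le hct.symm _ _)]

/-- Expansions in the basis `S n p` are determined by the values on partial bijections of each
coset-type. -/
theorem eq_sum_S_iff (u : D n) (c : (k : ℕ) → k.Partition → ℂ) :
    u = ∑ k ∈ Finset.range (n + 1), ∑ p : k.Partition, c k p • S n p ↔
      ∀ (a : PartialBij n) (k : ℕ) (p : k.Partition), cosetType a.map = p.parts → u a = c k p := by
  classical
  have key : ∀ (a : PartialBij n) (k : ℕ) (p : k.Partition), cosetType a.map = p.parts →
      (∑ k ∈ Finset.range (n + 1), ∑ p : k.Partition, c k p • S n p) a = c k p := by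
    intro a k p h
    have hk : k = a.dom.card := by rw [← PartialBij.cosetType_sum, h, p.parts_sum]
    rw [Finsupp.finsetSum_apply, Finset.sum_eq_single k, Finsupp.finsetSum_apply,
      Finset.sum_eq_single p]
    · rw [Finsupp.smul_apply, S_apply, if_pos h, smul_eq_mul, mul_one]
    · intro p' _ hp'
      rw [Finsupp.smul_apply, S_apply, if_neg, smul_zero]
      exact fun h' => hp' (Nat.Partition.ext (h'.symm.trans h))
    · simp
    · intro k' _ hk'
      rw [Finsupp.finsetSum_apply]
      refine Finset.sum_eq_zero fun p' _ => ?_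
      rw [Finsupp.smul_apply, S_apply, if_neg, smul_zero]
      intro h'
      apply hk'
      rw [hk, ← PartialBij.cosetType_sum, h', p'.parts_sum]
    · intro hk'
      refine absurd (Finset.mem_range.2 (Nat.lt_succ_of_le ?_)) hk'
      rw [hk]
      exact (Finset.card_le_univ _).trans_eq (Fintype.card_fin n)
  constructor
  · rintro h a k p hp
    rw [h]
    exact key a k p hp
  · intro h
    ext a
    obtain ⟨p, hp⟩ := a.exists_partition
    rw [h a _ p hp, key a _ p hp]

theorem exists_eq_sum_S (u : D n)
    (hu : ∀ a a' : PartialBij n, cosetType a.map = cosetType a'.map → u a = u a') :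
    ∃ c : (k : ℕ) → k.Partition → ℂ,
      u = ∑ k ∈ Finset.range (n + 1), ∑ p : k.Partition, c k p • S n p := by
  classical
  refine ⟨fun k p => if h : ∃ a : PartialBij n, cosetType a.map = p.parts then u h.choose else 0,
    (eq_sum_S_iff _ _).2 fun a k p h => ?_⟩
  have hex : ∃ a : PartialBij n, cosetType a.map = p.parts := ⟨a, h⟩
  rw [dif_pos hex]
  exact hu _ _ (h.trans hex.choose_spec.symm)

/-! ### The group algebra -/

open Classical in
theorem coeff_K {k : ℕ} (hk : k ≤ n) (p : k.Partition) (w : Perm (Pt n)) :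
    (K n p).coeff w = if HasType (twist w) p.parts then 1 else 0 := by
  rw [K, MonoidAlgebra.coeff_sum, Finsupp.finsetSum_apply, Finset.sum_filter]
  simp only [MonoidAlgebra.coeff_single, Finsupp.single_apply, PartialBij.cosetType_perm_iff _ hk]
  rw [Finset.sum_eq_single w]
  · simp
  · intro b _ hb
    simp [hb]
  · simp

theorem coeff_K_mul_K {l d : ℕ} (hl : l ≤ n) (hd : d ≤ n) (lam : l.Partition)
    (del : d.Partition) (w : Perm (Pt n)) :
    (K n lam * K n del).coeff w = Nat.card {q : Perm (Pt n) × Perm (Pt n) //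
      HasType (twist q.1) lam.parts ∧ HasType (twist q.2) del.parts ∧ q.1 * q.2 = w} := by
  classical
  rw [K, K, Finset.sum_mul_sum, MonoidAlgebra.coeff_sum, Finsupp.finsetSum_apply,
    Finset.sum_filter, Nat.card_eq_fintype_card, Fintype.card_subtype, Finset.card_filter,
    Fintype.sum_prod_type]
  push_cast
  refine Finset.sum_congr rfl fun w₁ _ => ?_
  simp only [PartialBij.cosetType_perm_iff _ hl]
  split_ifs with h
  · rw [MonoidAlgebra.coeff_sum, Finsupp.finsetSum_apply, Finset.sum_filter]
    refine Finset.sum_congr rfl fun w₂ _ => ?_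
    rw [MonoidAlgebra.single_mul_single, MonoidAlgebra.coeff_single, Finsupp.single_apply,
      one_mul]
    simp only [PartialBij.cosetType_perm_iff _ hd, h, true_and]
    split_ifs <;> simp_all
  · simp [h]

theorem coeff_K_mul_K_congr {l d : ℕ} (hl : l ≤ n) (hd : d ≤ n) (lam : l.Partition)
    (del : d.Partition) {w w' : Perm (Pt n)}
    (h : cosetType w.toPEquiv = cosetType w'.toPEquiv) :
    (K n lam * K n del).coeff w = (K n lam * K n del).coeff w' := by
  have key : ∀ {w w' : Perm (Pt n)}, cosetType w.toPEquiv = cosetType w'.toPEquiv →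
      Nat.card {q : Perm (Pt n) × Perm (Pt n) //
        HasType (twist q.1) lam.parts ∧ HasType (twist q.2) del.parts ∧ q.1 * q.2 = w} ≤
      Nat.card {q : Perm (Pt n) × Perm (Pt n) //
        HasType (twist q.1) lam.parts ∧ HasType (twist q.2) del.parts ∧ q.1 * q.2 = w'} := by
    intro w w' h
    obtain ⟨g, c, hg, hc, rfl, -⟩ := PartialBij.exists_preservesPair_mul
      (PartialBij.extends_ofPerm w) (PartialBij.extends_ofPerm w') h
    refine Nat.card_le_card_of_injective
      (fun u => ⟨(g * u.1.1, u.1.2 * c), ?_, ?_, ?_⟩) fun u u' e => ?_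
    · rw [twist_mul_left hg]
      exact u.2.1
    · rw [twist_mul_right hc, hasType_conj]
      exact u.2.2.1
    · have hu := u.2.2.2
      calc g * u.1.1 * (u.1.2 * c) = g * (u.1.1 * u.1.2) * c := by group
        _ = g * w * c := by rw [hu]
    · have e' := congrArg Subtype.val e
      simp only [Prod.mk.injEq, mul_right_inj, mul_left_inj] at e'
      exact Subtype.ext (Prod.ext e'.1 e'.2)
  rw [coeff_K_mul_K hl hd, coeff_K_mul_K hl hd, (key h).antisymm (key h.symm)]

/-- Restricting `w` to its broken pairs discards exactly the parts `1`. -/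
theorem exists_proper_partition (w : Perm (Pt n)) : ∃ k, k ≤ n ∧ ∃ p : k.Partition,
    IsProper p ∧ HasType (twist w) p.parts := by
  obtain ⟨a, hd, ha⟩ := PartialBij.exists_restrict w (brokenPairs w)
    fun x hx => by rwa [mem_brokenPairs, not_not] at hx
  obtain ⟨p, hp⟩ := a.exists_partition
  refine ⟨_, (Finset.card_le_univ _).trans_eq (Fintype.card_fin n), p, ?_,
    ((PartialBij.cosetType_eq_parts_iff ha p).1 hp).2⟩
  rw [IsProper, ← hp]
  intro h1
  have h2 := PartialBij.count_cosetType ha.1 1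
  have h3 : 0 < (cosetType a.map).count 1 := Multiset.count_pos.2 h1
  have h4 : 0 < stat (twist w) a.dom 1 := by omega
  rw [stat, Nat.card_pos_iff] at h4
  obtain ⟨⟨x, hx, hx1⟩⟩ := h4.1
  rw [hd, mem_brokenPairs, preservesPair_iff] at hx
  exact hx (minimalPeriod_eq_one.1 hx1)

theorem parts_eq_of_hasType {v : Perm (Pt n)} {k k' : ℕ} {p : k.Partition} {p' : k'.Partition}
    (hp : IsProper p) (hp' : IsProper p') (h : HasType v p.parts) (h' : HasType v p'.parts) :
    p.parts = p'.parts := by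
  ext j
  rcases Nat.lt_or_ge j 2 with hj | hj
  · interval_cases j
    · rw [Multiset.count_eq_zero.2 fun h0 => (p.parts_pos h0).ne' rfl,
        Multiset.count_eq_zero.2 fun h0 => (p'.parts_pos h0).ne' rfl]
    · rw [Multiset.count_eq_zero.2 hp, Multiset.count_eq_zero.2 hp']
  · exact Nat.eq_of_mul_eq_mul_right (by omega) ((h j hj).symm.trans (h' j hj))

open Classical in
theorem eq_sum_K_iff (u : MonoidAlgebra ℂ (Perm (Pt n))) (c : (k : ℕ) → k.Partition → ℂ) :
    u = ∑ k ∈ Finset.range (n + 1), ∑ p : k.Partition with IsProper p, c k p • K n p ↔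
      ∀ (w : Perm (Pt n)) (k : ℕ) (p : k.Partition), k ≤ n → IsProper p →
        HasType (twist w) p.parts → u.coeff w = c k p := by
  have key : ∀ (w : Perm (Pt n)) (k : ℕ) (p : k.Partition), k ≤ n → IsProper p →
      HasType (twist w) p.parts → (∑ k ∈ Finset.range (n + 1),
        ∑ p : k.Partition with IsProper p, c k p • K n p).coeff w = c k p := by
    intro w k p hk hp h
    rw [MonoidAlgebra.coeff_sum, Finsupp.finsetSum_apply, Finset.sum_eq_single k,
      MonoidAlgebra.coeff_sum, Finsupp.finsetSum_apply, Finset.sum_eq_single p]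
    · rw [MonoidAlgebra.coeff_smul, Finsupp.smul_apply, coeff_K hk, if_pos h, smul_eq_mul, mul_one]
    · intro p' hp' hne
      rw [MonoidAlgebra.coeff_smul, Finsupp.smul_apply, coeff_K hk, if_neg, smul_zero]
      exact fun h' => hne (Nat.Partition.ext
        (parts_eq_of_hasType (Finset.mem_filter.1 hp').2 hp h' h))
    · intro hp'
      exact absurd (Finset.mem_filter.2 ⟨Finset.mem_univ _, hp⟩) hp'
    · intro k' hk' hne
      rw [MonoidAlgebra.coeff_sum, Finsupp.finsetSum_apply]
      refine Finset.sum_eq_zero fun p' hp' => ?_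
      rw [MonoidAlgebra.coeff_smul, Finsupp.smul_apply,
        coeff_K (Nat.le_of_lt_succ (Finset.mem_range.1 hk')), if_neg, smul_zero]
      intro h'
      apply hne
      rw [← p'.parts_sum, parts_eq_of_hasType (Finset.mem_filter.1 hp').2 hp h' h, p.parts_sum]
    · intro hk'
      exact absurd (Finset.mem_range.2 (Nat.lt_succ_of_le hk)) hk'
  constructor
  · rintro h w k p hk hp hw
    rw [h]
    exact key w k p hk hp hw
  · intro h
    ext w
    obtain ⟨k, hk, p, hp, hw⟩ := exists_proper_partition w
    rw [h w k p hk hp hw, key w k p hk hp hw]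

theorem exists_heckeExpansion {l d : ℕ} (hl : l ≤ n) (hd : d ≤ n) (lam : l.Partition)
    (del : d.Partition) : ∃ a, IsHeckeExpansion n lam del a := by
  classical
  refine ⟨fun k p => if h : ∃ w : Perm (Pt n), HasType (twist w) p.parts then
    (K n lam * K n del).coeff h.choose else 0, (eq_sum_K_iff _ _).2 fun w k p hk hp h => ?_⟩
  have hex : ∃ w : Perm (Pt n), HasType (twist w) p.parts := ⟨w, h⟩
  rw [dif_pos hex]
  exact coeff_K_mul_K_congr hl hd lam del (((PartialBij.cosetType_perm_iff w hk p).2 h).trans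
    ((PartialBij.cosetType_perm_iff _ hk p).2 hex.choose_spec).symm)

end Invariance

/-! ### Counting by matchings: reduction to numbers independent of `n` -/

section Counting

variable {n : ℕ}

theorem exists_twist_eq {v : Perm (Pt n)} (hv : IsMatchingPair (swap n) v) :
    ∃ w, twist w = v := by
  -- Any two perfect matchings are conjugate: each is paired with itself, so the rotation is `1` and
  -- all statistics agree trivially. The conjugating `φ` carries `swap n` to `swap n * v`.
  have h1 : IsMatchingPair (swap n) 1 := ⟨swap_swap, fun x => swap_swap x, swap_ne, swap_ne⟩
  have h2 : IsMatchingPair (swap n * v) 1 :=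
    ⟨hv.sq', hv.sq', hv.fpf', hv.fpf'⟩
  obtain ⟨φ, hφ, -, -⟩ := h1.exists_intertwining h2 (fun _ => ()) (fun _ => ())
    (fun _ _ _ => rfl) (fun _ _ _ => rfl) (fun _ _ => rfl)
  refine ⟨φ⁻¹, ?_⟩
  ext1 x
  rw [twist_apply, inv_inv, hφ, perm_apply_inv_self, Perm.mul_apply, swap_swap]

/-- All fibers of `twist` have the same size. -/
theorem card_twist_eq {v : Perm (Pt n)} (hv : IsMatchingPair (swap n) v) :
    Nat.card {w // twist w = v} = 2 ^ n * n.factorial := by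
  obtain ⟨w₀, rfl⟩ := exists_twist_eq hv
  rw [← card_forall_preservesPair]
  symm
  -- The fibre through `w₀` is its coset under left multiplication by the hyperoctahedral group.
  refine Nat.card_eq_of_bijective (fun g => ⟨g.1 * w₀, twist_mul_left g.2 w₀⟩) ⟨?_, ?_⟩
  · intro g g' h
    exact Subtype.ext (mul_right_cancel (congrArg Subtype.val h))
  · rintro ⟨w, hw⟩
    refine ⟨⟨w * w₀⁻¹, fun x => ?_⟩, Subtype.ext (inv_mul_cancel_right _ _)⟩
    have h1 := congrArg (fun f : Perm (Pt n) => f (w₀⁻¹ x)) hw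
    simp only [twist_apply, perm_apply_inv_self, (swap n).injective.eq_iff,
      Perm.inv_eq_iff_eq] at h1
    rw [PreservesPair, Perm.mul_apply, ← h1]
    rfl

theorem card_twist_inv_eq {v : Perm (Pt n)} (hv : IsMatchingPair (swap n) v) :
    Nat.card {w // twist w⁻¹ = v} = 2 ^ n * n.factorial := by
  rw [← card_twist_eq hv]
  exact Nat.card_congr ((Equiv.inv (Perm (Pt n))).subtypeEquiv fun w => Iff.rfl)

open Classical in
/-- The indices of the pairs moved by `v`. -/
noncomputable def movedPairs (v : Perm (Pt n)) : Finset (Fin n) :=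
  {i | v (i, false) ≠ (i, false)}

theorem mem_movedPairs {v : Perm (Pt n)} {i : Fin n} :
    i ∈ movedPairs v ↔ v (i, false) ≠ (i, false) := by
  simp [movedPairs]

theorem movedPairs_twist (w : Perm (Pt n)) : movedPairs (twist w) = brokenPairs w := by
  ext i
  rw [mem_movedPairs, mem_brokenPairs (x := (i, false)), preservesPair_iff]

theorem movedPairs_lift {m : ℕ} (f : Fin m ↪ Fin n) (v : Perm (Pt m)) :
    movedPairs (lift f v) = (movedPairs v).map f := by
  ext i
  rw [mem_movedPairs, Finset.mem_map]
  constructor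
  · intro h
    obtain h1 | ⟨⟨j, b⟩, h1⟩ := pair_cases f (i, false)
    · exact absurd (lift_apply_of_notMem f v h1) h
    · simp only [Prod.mk.injEq] at h1
      obtain ⟨rfl, rfl⟩ := h1
      refine ⟨j, mem_movedPairs.2 fun h2 => h ?_, rfl⟩
      exact (lift_apply f v (j, false)).trans (by rw [h2])
  · rintro ⟨j, hj, rfl⟩ h
    rw [lift_apply f v (j, false)] at h
    exact mem_movedPairs.1 hj ((embed_inj f (y := (j, false))).1 h)

theorem isMatchingPair_lift {m : ℕ} (f : Fin m ↪ Fin n) (v : Perm (Pt m)) :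
    IsMatchingPair (swap n) (lift f v) ↔ IsMatchingPair (swap m) v := by
  constructor
  · intro h
    refine ⟨swap_swap, fun x => ?_, swap_ne, fun x hx => ?_⟩
    · have h1 := h.sq' (f x.1, x.2)
      rw [lift_apply, swap_embed, lift_apply, swap_embed, embed_inj] at h1
      exact h1
    · apply h.fpf' (f x.1, x.2)
      rw [lift_apply, swap_embed, hx]
  · intro h
    refine ⟨swap_swap, fun x => ?_, swap_ne, fun x hx => ?_⟩
    · obtain h1 | ⟨y, rfl⟩ := pair_cases f x
      · rw [lift_apply_of_notMem f v h1, lift_apply_of_notMem f v (by exact h1), swap_swap]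
      · rw [lift_apply, swap_embed, lift_apply, swap_embed, embed_inj]
        exact h.sq' y
    · obtain h1 | ⟨y, rfl⟩ := pair_cases f x
      · rw [lift_apply_of_notMem f v h1] at hx
        exact swap_ne _ hx
      · rw [lift_apply, swap_embed, embed_inj] at hx
        exact h.fpf' y hx

theorem map_enum_univ {k : ℕ} {e : Finset (Fin n)} (h : e.card = k) :
    Finset.univ.map (enum e h) = e := by
  ext i
  rw [← mem_range_enum h]
  simp

theorem exists_lift_twist {k : ℕ} {e : Finset (Fin n)} (h : e.card = k) {w : Perm (Pt n)}
    (hw : brokenPairs w ⊆ e) : ∃ v, lift (enum e h) v = twist w ∧ IsMatchingPair (swap k) v := by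
  obtain ⟨v, hv⟩ := exists_lift (enum e h) (twist w) fun x hx => by
    rw [mem_range_enum] at hx
    by_contra hne
    rw [← preservesPair_iff, ← mem_brokenPairs] at hne
    exact hx (hw hne)
  refine ⟨v, hv, ?_⟩
  rw [← isMatchingPair_lift (enum e h), hv]
  exact isMatchingPair_twist w

theorem twist_inv (w : Perm (Pt n)) : twist w⁻¹ = w⁻¹⁻¹ * (twist w)⁻¹ * w⁻¹ := by
  have e : (swap n)⁻¹ = swap n := swap_inv
  rw [twist, twist, mul_inv_rev, mul_inv_rev, mul_inv_rev, e]
  group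

theorem hasType_twist_inv (w : Perm (Pt n)) (p : Multiset ℕ) :
    HasType (twist w⁻¹) p ↔ HasType (twist w) p := by
  rw [twist_inv, hasType_conj, hasType_inv]

/-- Conjugation by `w₂` turns the two matchings of the product into `w₂ * swap n * w₂⁻¹` and `w₁⁻¹ *
swap n * w₁`. So the three types compare, two at a time, the three matchings formed by these and the
pairs. -/
theorem hasType_twist_mul (w₁ w₂ : Perm (Pt n)) (p : Multiset ℕ) :
    HasType (twist (w₁ * w₂)) p ↔ HasType ((twist w₂⁻¹)⁻¹ * twist w₁) p := by
  have e : (swap n)⁻¹ = swap n := swap_inv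
  have : twist (w₁ * w₂) = w₂⁻¹ * ((twist w₂⁻¹)⁻¹ * twist w₁) * w₂ := by
    have e2 : swap n * swap n = 1 := Equiv.ext swap_swap
    calc twist (w₁ * w₂) = swap n * w₂⁻¹ * 1 * w₁⁻¹ * swap n * w₁ * w₂ := by rw [twist]; group
      _ = w₂⁻¹ * ((twist w₂⁻¹)⁻¹ * twist w₁) * w₂ := by
        rw [← e2, twist, twist, mul_inv_rev, mul_inv_rev, mul_inv_rev, e]
        group
  rw [this, hasType_conj]

/-- The number of permutations `v` of `[2k]` forming a matching pair with the pairs, of type `p`. -/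
noncomputable def singleCount (k : ℕ) (p : Multiset ℕ) : ℕ :=
  Nat.card {v : Perm (Pt k) // IsMatchingPair (swap k) v ∧ HasType v p}

/-- The number of pairs of matchings of `[2k]` that move every pair, and have prescribed types
with respect to the pairs and to each other. -/
noncomputable def pairCount (k : ℕ) (p q r : Multiset ℕ) : ℕ :=
  Nat.card {v : Perm (Pt k) × Perm (Pt k) // (IsMatchingPair (swap k) v.1 ∧ HasType v.1 p) ∧
    (IsMatchingPair (swap k) v.2 ∧ HasType v.2 q) ∧ HasType (v.2⁻¹ * v.1) r ∧
    movedPairs v.1 ∪ movedPairs v.2 = Finset.univ}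

theorem card_subsets (n k : ℕ) : Nat.card {e : Finset (Fin n) // e.card = k} = n.choose k := by
  rw [Nat.card_eq_fintype_card, Fintype.card_finset_len, Fintype.card_fin]

theorem card_sigma_const {α : Type*} [Finite α] {β : α → Type*} [∀ a, Finite (β a)] {c : ℕ}
    (h : ∀ a, Nat.card (β a) = c) : Nat.card (Σ a, β a) = Nat.card α * c := by
  have := Fintype.ofFinite α
  rw [Nat.card_sigma, Fintype.sum_congr _ _ h, Finset.sum_const, Finset.card_univ, smul_eq_mul,
    Nat.card_eq_fintype_card]

/-- The binomial chooses the set `e` of pairs moved by one of the two twists, `pairCount` chooses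
the twists on `e`, and the last factor is the size of the fibres of `twist` in each argument. -/
theorem card_pairs_hasType (n k : ℕ) (p q r : Multiset ℕ) :
    Nat.card {w : Perm (Pt n) × Perm (Pt n) // HasType (twist w.1) p ∧ HasType (twist w.2) q ∧
      HasType (twist (w.1 * w.2)) r ∧ (brokenPairs w.1 ∪ brokenPairs w.2⁻¹).card = k} =
      n.choose k * pairCount k p q r * (2 ^ n * n.factorial * (2 ^ n * n.factorial)) := by
  rw [← card_subsets, pairCount, ← Nat.card_prod]
  let B : {e : Finset (Fin n) // e.card = k} × {v : Perm (Pt k) × Perm (Pt k) //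
      (IsMatchingPair (swap k) v.1 ∧ HasType v.1 p) ∧
      (IsMatchingPair (swap k) v.2 ∧ HasType v.2 q) ∧ HasType (v.2⁻¹ * v.1) r ∧
      movedPairs v.1 ∪ movedPairs v.2 = Finset.univ} → Type := fun s =>
    {w // twist w = lift (enum s.1.1 s.1.2) s.2.1.1} ×
      {w // twist w⁻¹ = lift (enum s.1.1 s.1.2) s.2.1.2}
  have hB : ∀ s, Nat.card (B s) = 2 ^ n * n.factorial * (2 ^ n * n.factorial) := fun s => by
    rw [Nat.card_prod, card_twist_eq ((isMatchingPair_lift _ _).2 s.2.2.1.1),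
      card_twist_inv_eq ((isMatchingPair_lift _ _).2 s.2.2.2.1.1)]
  have : ∀ s, Finite (B s) := fun s => inferInstanceAs (Finite (_ × _))
  rw [← card_sigma_const hB]
  -- The condition in `pairCount` that every pair is moved makes `e` recoverable from the
  -- permutations, which gives injectivity.
  have hjoint : ∀ s (w : B s), brokenPairs w.1.1 ∪ brokenPairs w.2.1⁻¹ = s.1.1 := by
    rintro ⟨⟨e, he⟩, ⟨v₁, v₂⟩, -, -, -, hv⟩ ⟨⟨w₁, h₁⟩, ⟨w₂, h₂⟩⟩
    rw [← movedPairs_twist, ← movedPairs_twist, h₁, h₂, movedPairs_lift, movedPairs_lift,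
      ← Finset.map_union]
    exact (congrArg (Finset.map (enum e he)) hv).trans (map_enum_univ he)
  symm
  refine Nat.card_eq_of_bijective (fun s => ⟨(s.2.1.1, s.2.2.1), ?_, ?_, ?_, ?_⟩) ⟨?_, ?_⟩
  · rw [s.2.1.2, hasType_lift]
    exact s.1.2.2.1.2
  · rw [← hasType_twist_inv, s.2.2.2, hasType_lift]
    exact s.1.2.2.2.1.2
  · rw [hasType_twist_mul, s.2.1.2, s.2.2.2, ← map_inv, ← map_mul, hasType_lift]
    exact s.1.2.2.2.2.1
  · rw [hjoint]
    exact s.1.1.2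
  · rintro ⟨⟨⟨e, he⟩, ⟨v₁, v₂⟩, hv⟩, w⟩ ⟨⟨⟨e', he'⟩, ⟨v₁', v₂'⟩, hv'⟩, w'⟩ h
    have h' := congrArg Subtype.val h
    simp only [Prod.mk.injEq] at h'
    have h1 := hjoint _ w
    have h2 := hjoint _ w'
    simp only at h1 h2
    rw [h'.1, h'.2, h2] at h1
    subst h1
    obtain ⟨⟨w₁, h₁⟩, ⟨w₂, h₂⟩⟩ := w
    obtain ⟨⟨w₁', h₁'⟩, ⟨w₂', h₂'⟩⟩ := w'
    obtain ⟨rfl, rfl⟩ := h'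
    obtain rfl : v₁ = v₁' := lift_injective _ (h₁.symm.trans h₁')
    obtain rfl : v₂ = v₂' := lift_injective _ (h₂.symm.trans h₂')
    rfl
  · rintro ⟨⟨w₁, w₂⟩, h₁, h₂, h₃, h₄⟩
    obtain ⟨v₁, hv₁, hm₁⟩ := exists_lift_twist h₄ (w := w₁) Finset.subset_union_left
    obtain ⟨v₂, hv₂, hm₂⟩ := exists_lift_twist h₄ (w := w₂⁻¹) Finset.subset_union_right
    refine ⟨⟨⟨⟨_, h₄⟩, ⟨(v₁, v₂), ⟨hm₁, ?_⟩, ⟨hm₂, ?_⟩, ?_, ?_⟩⟩, ⟨⟨w₁, hv₁.symm⟩,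
      ⟨w₂, hv₂.symm⟩⟩⟩, rfl⟩
    · rwa [← hasType_lift (enum _ h₄), hv₁]
    · rwa [← hasType_lift (enum _ h₄), hv₂, hasType_twist_inv]
    · rwa [← hasType_lift (enum _ h₄), map_mul, map_inv, hv₁, hv₂, ← hasType_twist_mul]
    · apply Finset.map_injective (enum _ h₄)
      rw [Finset.map_union, ← movedPairs_lift, ← movedPairs_lift, hv₁, hv₂, movedPairs_twist,
        movedPairs_twist, map_enum_univ]

open PartialBij in
-- Double counting of pairs consisting of `a` and an extension `w`: given `w`, the choice of `a` is
-- the choice of a domain of size `k` containing the broken pairs. Parts `1` in `p` are allowed,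
-- since the domain may contain preserved pairs.
theorem card_extends_hasType (n : ℕ) {k : ℕ} (p : k.Partition) :
    Nat.card {a : PartialBij n // cosetType a.map = p.parts} * extCount n k =
      n.choose k * singleCount k p.parts * (2 ^ n * n.factorial) := by
  have h1 : Nat.card (Σ a : {a : PartialBij n // cosetType a.map = p.parts},
      {w // Extends a.1 w}) =
      Nat.card {a : PartialBij n // cosetType a.map = p.parts} * extCount n k :=
    card_sigma_const fun a => by
      rw [card_extends, ← cosetType_sum, a.2, p.parts_sum, extCount]
  let B : {e : Finset (Fin n) // e.card = k} × {v : Perm (Pt k) //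
      IsMatchingPair (swap k) v ∧ HasType v p.parts} → Type := fun s =>
    {w // twist w = lift (enum s.1.1 s.1.2) s.2.1}
  have hB : ∀ s, Nat.card (B s) = 2 ^ n * n.factorial := fun s =>
    card_twist_eq ((isMatchingPair_lift _ _).2 s.2.2.1)
  have : ∀ s, Finite (B s) := fun s => inferInstanceAs (Finite {w // _})
  rw [← h1, ← card_subsets, singleCount, ← Nat.card_prod, ← card_sigma_const hB]
  have hsub : ∀ s (w : B s), brokenPairs w.1 ⊆ s.1.1 := fun s w => by
    rw [← movedPairs_twist, w.2, movedPairs_lift]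
    exact (Finset.map_subset_map.2 (Finset.subset_univ _)).trans (map_enum_univ s.1.2).subset
  trans Nat.card {q : Finset (Fin n) × Perm (Pt n) //
    q.1.card = k ∧ brokenPairs q.2 ⊆ q.1 ∧ HasType (twist q.2) p.parts}
  · refine Nat.card_eq_of_bijective (fun a => ⟨(a.1.1.dom, a.2.1), ?_, fun i hi => ?_, ?_⟩)
      ⟨?_, ?_⟩
    · exact ((cosetType_eq_parts_iff a.2.2 p).1 a.1.2).1
    · by_contra hi'
      rw [mem_brokenPairs (x := (i, false))] at hi
      exact hi (a.2.2.2 _ hi')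
    · exact ((cosetType_eq_parts_iff a.2.2 p).1 a.1.2).2
    · rintro ⟨⟨a, ha⟩, w, hw⟩ ⟨⟨a', ha'⟩, w', hw'⟩ h
      have h' := congrArg Subtype.val h
      simp only [Prod.mk.injEq] at h'
      obtain ⟨hd, rfl⟩ := h'
      obtain rfl := ext_of_le hw.1 hw'.1 hd
      rfl
    · rintro ⟨⟨e, w⟩, he, hb, hw⟩
      obtain ⟨a, rfl, ha⟩ := exists_restrict w e fun x hx => by
        by_contra hx'
        exact hx (hb (mem_brokenPairs.2 hx'))
      exact ⟨⟨⟨a, (cosetType_eq_parts_iff ha p).2 ⟨he, hw⟩⟩, ⟨w, ha⟩⟩, rfl⟩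
  · symm
    refine Nat.card_eq_of_bijective (fun s => ⟨(s.1.1.1, s.2.1), s.1.1.2, hsub _ _, ?_⟩)
      ⟨?_, ?_⟩
    · rw [s.2.2, hasType_lift]
      exact s.1.2.2.2
    · rintro ⟨⟨⟨e, he⟩, v, hv⟩, w, hw⟩ ⟨⟨⟨e', he'⟩, v', hv'⟩, w', hw'⟩ h
      have h' := congrArg Subtype.val h
      simp only [Prod.mk.injEq] at h'
      obtain ⟨rfl, rfl⟩ := h'
      obtain rfl : v = v' := lift_injective _ (hw.symm.trans hw')
      rfl
    · rintro ⟨⟨e, w⟩, he, hb, hw⟩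
      obtain ⟨v, hv, hm⟩ := exists_lift_twist he hb
      refine ⟨⟨⟨⟨e, he⟩, ⟨v, hm, ?_⟩⟩, ⟨w, hv.symm⟩⟩, rfl⟩
      rwa [← hasType_lift (enum e he), hv]

open PartialBij in
/-- The total coefficient of a coset-type in the product of `S n lam` and `S n del`. -/
theorem card_mul_coeff {l d k : ℕ} {lam : l.Partition} {del : d.Partition} {p : k.Partition}
    (hlam : IsProper lam) (hdel : IsProper del) (hl : l ≤ n) (hd : d ≤ n) {c : ℂ}
    (hc : ∀ a : PartialBij n, cosetType a.map = p.parts → D.mul (S n lam) (S n del) a = c) :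
    (Nat.card {a : PartialBij n // cosetType a.map = p.parts} : ℂ) *
      ((extCount n l * extCount n d : ℂ) * c) =
      (n.choose k * pairCount k lam.parts del.parts p.parts *
        (2 ^ n * n.factorial * (2 ^ n * n.factorial)) : ℕ) := by
  classical
  have h1 : (Nat.card {a : PartialBij n // cosetType a.map = p.parts} : ℂ) *
      ((extCount n l * extCount n d : ℂ) * c) =
      ∑ a : {a : PartialBij n // cosetType a.map = p.parts},
        (Nat.card {w : Perm (Pt n) × Perm (Pt n) // HasType (twist w.1) lam.parts ∧
          HasType (twist w.2) del.parts ∧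
          IsProductOver a.1 (brokenPairs w.1 ∪ brokenPairs w.2⁻¹) w.1 w.2} : ℂ) := by
    rw [Nat.card_eq_fintype_card, ← nsmul_eq_mul, ← Finset.card_univ, ← Finset.sum_const]
    refine Finset.sum_congr rfl fun a _ => ?_
    rw [← hc a.1 a.2, extCount_mul_mul_S_apply hlam hdel hl hd]
  rw [h1, ← Nat.cast_sum, ← Nat.card_sigma, ← card_pairs_hasType]
  congr 1
  -- Summed over all `a` of type `p`, each pair `(w₁, w₂)` counts once: `a` is the composition of
  -- its restrictions to the joint set of broken pairs, so the size of that set is `k`.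
  have hext : ∀ {a : PartialBij n} {w : Perm (Pt n) × Perm (Pt n)},
      IsProductOver a (brokenPairs w.1 ∪ brokenPairs w.2⁻¹) w.1 w.2 →
        Extends a (w.1 * w.2) ∧ a.dom.card = (brokenPairs w.1 ∪ brokenPairs w.2⁻¹).card := by
    rintro a ⟨w₁, w₂⟩ h
    obtain ⟨b, hb, hb'⟩ := exists_restrict w₁ (brokenPairs w₁ ∪ brokenPairs w₂⁻¹) fun x hx => by
      by_contra hx'
      exact hx (Finset.mem_union_left _ (mem_brokenPairs.2 hx'))
    obtain ⟨c, hc, hc'⟩ := exists_corestrict w₂ (brokenPairs w₁ ∪ brokenPairs w₂⁻¹) fun x hx => by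
      by_contra hx'
      exact hx (Finset.mem_union_right _ (mem_brokenPairs.2 hx'))
    have hbc : b.dom = c.cod := hb.trans hc.symm
    rw [show (brokenPairs (w₁, w₂).1 ∪ brokenPairs (w₁, w₂).2⁻¹) = c.cod from hc.symm] at h ⊢
    obtain rfl := (isProductOver_iff hbc hb' hc').1 h
    obtain ⟨h2, h3⟩ := comp_extends hbc hb' hc'
    exact ⟨h3, by rw [h2, card_cod]⟩
  refine Nat.card_eq_of_bijective (fun s => ⟨s.2.1, s.2.2.1, s.2.2.2.1, ?_, ?_⟩) ⟨?_, ?_⟩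
  · exact ((cosetType_eq_parts_iff (hext s.2.2.2.2).1 p).1 s.1.2).2
  · rw [← (hext s.2.2.2.2).2]
    exact ((cosetType_eq_parts_iff (hext s.2.2.2.2).1 p).1 s.1.2).1
  · rintro ⟨⟨a, ha⟩, w, h1, h2, h3⟩ ⟨⟨a', ha'⟩, w', h1', h2', h3'⟩ h
    obtain rfl : w = w' := congrArg Subtype.val h
    obtain rfl : a = a' := ext_of_le h3.1 h3'.1 (by
      ext i
      rw [h3.2 (i, false), h3'.2 (i, false)])
    rfl
  · rintro ⟨w, h1, h2, h3, h4⟩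
    obtain ⟨b, hb, hb'⟩ := exists_restrict w.1 (brokenPairs w.1 ∪ brokenPairs w.2⁻¹)
      fun x hx => by
        by_contra hx'
        exact hx (Finset.mem_union_left _ (mem_brokenPairs.2 hx'))
    obtain ⟨c, hc, hc'⟩ := exists_corestrict w.2 (brokenPairs w.1 ∪ brokenPairs w.2⁻¹)
      fun x hx => by
        by_contra hx'
        exact hx (Finset.mem_union_right _ (mem_brokenPairs.2 hx'))
    have hbc : b.dom = c.cod := hb.trans hc.symm
    have h5 := (isProductOver_iff hbc hb' hc').2 rfl
    rw [hc] at h5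
    have h6 := hext h5
    exact ⟨⟨⟨b.comp c hbc, (cosetType_eq_parts_iff h6.1 p).2 ⟨h6.2.trans h4, h3⟩⟩,
      ⟨w, h1, h2, h5⟩⟩, rfl⟩

end Counting

/-! ### Realising all types, and counting in the group algebra -/

section Hecke

variable {n : ℕ}

theorem minimalPeriod_finRotate (j : ℕ) (i : Fin j) : minimalPeriod (finRotate j) i = j := by
  obtain _ | j := j
  · exact i.elim0
  have hit : ∀ k : ℕ, ((finRotate (j + 1))^[k] i).val = (i.val + k) % (j + 1) := fun k => by
    induction k with
    | zero => exact (Nat.mod_eq_of_lt i.2).symm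
    | succ k ih =>
      rw [iterate_succ_apply', finRotate_apply, Fin.val_add, ih, Fin.val_one', ← Nat.add_mod,
        add_assoc]
  have : ∀ k, IsPeriodicPt (finRotate (j + 1)) k i ↔ j + 1 ∣ k := fun k => by
    rw [IsPeriodicPt, IsFixedPt, Fin.ext_iff, hit, ← Nat.modEq_zero_iff_dvd]
    have h : (i.val + k) % (j + 1) = i.val ↔ i.val + k ≡ i.val + 0 [MOD j + 1] := by
      rw [Nat.ModEq, add_zero, Nat.mod_eq_of_lt i.2]
    rw [h]
    exact ⟨Nat.ModEq.add_left_cancel' i.val, Nat.ModEq.add_left i.val⟩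
  apply Nat.dvd_antisymm
  · rw [← isPeriodicPt_iff_minimalPeriod_dvd, this]
  · rw [← this]
    exact isPeriodicPt_minimalPeriod _ _

/-- Every partition of `m` is a coset-type. -/
theorem exists_hasType {m : ℕ} (p : m.Partition) :
    ∃ w : Perm (Pt m), HasType (twist w) p.parts := by
  have hle : ∀ j ∈ p.parts, j ≤ m := fun j hj => by
    rw [← p.parts_sum]
    exact Multiset.le_sum_of_mem hj
  let Y := Σ j : Fin (m + 1), Fin (p.parts.count j.1) × Fin j.1
  have hY : Fintype.card Y = m := by
    simp only [Y, Fintype.card_sigma, Fintype.card_prod, Fintype.card_fin]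
    rw [Fin.sum_univ_eq_sum_range (fun j => p.parts.count j * j) (m + 1)]
    conv_rhs => rw [← p.parts_sum, Finset.sum_multiset_count_of_subset p.parts
      (Finset.range (m + 1)) fun j hj => Finset.mem_range.2
        (Nat.lt_succ_of_le (hle j (Multiset.mem_toFinset.1 hj)))]
    rfl
  let e : Y ≃ Fin m := Fintype.equivFinOfCardEq hY
  let π : Perm Y := Equiv.sigmaCongrRight fun j => Equiv.prodCongr (Equiv.refl _) (finRotate j.1)
  have hπ : ∀ y : Y, minimalPeriod π y = y.1.1 := by
    rintro ⟨j, c, i⟩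
    have := minimalPeriod_of_semiconj (f := finRotate j.1) (g := π)
      (φ := fun i => (⟨j, c, i⟩ : Y)) (fun i i' h => by
        have := eq_of_heq (Sigma.mk.inj h).2
        exact (Prod.mk.inj this).2) (fun _ => rfl) i
    rw [this, minimalPeriod_finRotate]
  let π' : Perm (Fin m) := e.permCongr π
  have hπ' : ∀ y, minimalPeriod π' (e y) = y.1.1 := fun y => by
    rw [minimalPeriod_of_semiconj (f := π) e.injective (fun y => by simp [π']) y, hπ]
  -- Acting by `π'` on the second elements only makes `twist w` equal to `π'` on the `true` copy and
  -- to `π'⁻¹` on the `false` one, so each cycle of `π'` gives one part.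
  let w : Perm (Pt m) :=
    { toFun := fun x => (cond x.2 (π' x.1) x.1, x.2)
      invFun := fun x => (cond x.2 (π'⁻¹ x.1) x.1, x.2)
      left_inv := by rintro ⟨i, _ | _⟩ <;> simp
      right_inv := by rintro ⟨i, _ | _⟩ <;> simp }
  have hw : ∀ y b, minimalPeriod (twist w) (e y, b) = y.1.1 := by
    rintro y (_ | _)
    · rw [minimalPeriod_of_semiconj (f := (π'⁻¹ : Perm (Fin m))) (φ := fun i => (i, false))
        (Prod.mk_left_injective false) (fun i => rfl) (e y), minimalPeriod_inv, hπ']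
    · rw [minimalPeriod_of_semiconj (f := π') (φ := fun i => (i, true))
        (Prod.mk_left_injective true) (fun i => rfl) (e y), hπ']
  refine ⟨w, fun j hj => ?_⟩
  have h1 : stat (twist w) Finset.univ j = Nat.card {z : Y × Bool // z.1.1.1 = j} := by
    symm
    refine Nat.card_congr (Equiv.subtypeEquiv (e.prodCongr (Equiv.refl Bool)) fun z => ?_)
    have h2 : minimalPeriod (twist w) (e.prodCongr (Equiv.refl Bool) z) = _ := hw z.1 z.2
    rw [h2]
    simp
  rw [h1]
  by_cases hjm : j < m + 1
  · let f : {z : Y × Bool // z.1.1.1 = j} ≃ (Fin (p.parts.count j) × Fin j) × Bool :=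
      { toFun := fun z => ((Fin.cast (by rw [z.2]) z.1.1.2.1, Fin.cast z.2 z.1.1.2.2), z.1.2)
        invFun := fun z => ⟨(⟨⟨j, hjm⟩, z.1⟩, z.2), rfl⟩
        left_inv := by
          rintro ⟨⟨⟨⟨j', hj'⟩, c, i⟩, b⟩, h⟩
          obtain rfl : j' = j := h
          rfl
        right_inv := fun z => rfl }
    rw [Nat.card_congr f]
    simp
    ring
  · rw [Multiset.count_eq_zero.2 fun hmem => hjm (Nat.lt_succ_of_le (hle j hmem)), zero_mul,
      Nat.card_eq_zero]
    refine Or.inl ⟨fun z => hjm ?_⟩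
    rw [← z.2]
    exact z.1.1.1.2

theorem singleCount_pos {m : ℕ} (p : m.Partition) : 0 < singleCount m p.parts := by
  obtain ⟨w, hw⟩ := exists_hasType p
  exact Nat.card_pos_iff.2 ⟨⟨⟨twist w, isMatchingPair_twist w, hw⟩⟩, inferInstance⟩

open PartialBij in
-- For proper `p` each permutation of type `p` extends exactly one partial bijection of coset-type
-- `p`, so the count of extensions becomes a count of permutations.
theorem card_hasType {k : ℕ} (hk : k ≤ n) {p : k.Partition} (hp : IsProper p) :
    Nat.card {w : Perm (Pt n) // HasType (twist w) p.parts} =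
      n.choose k * singleCount k p.parts * (2 ^ n * n.factorial) := by
  rw [← card_extends_hasType, ← card_sigma_const (α := {a : PartialBij n //
    cosetType a.map = p.parts}) (β := fun a => {w // Extends a.1 w}) fun a => by
      rw [card_extends, ← cosetType_sum, a.2, p.parts_sum, extCount]]
  symm
  refine Nat.card_eq_of_bijective
    (fun a => ⟨a.2.1, ((cosetType_eq_parts_iff a.2.2 p).1 a.1.2).2⟩) ⟨?_, ?_⟩
  · rintro ⟨⟨a, ha⟩, w, hw⟩ ⟨⟨a', ha'⟩, w', hw'⟩ h
    obtain rfl : w = w' := congrArg Subtype.val h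
    obtain rfl : a = a' := ext_of_le hw.1 hw'.1 (by
      rw [dom_eq_brokenPairs hw (by rw [ha]; exact hp),
        dom_eq_brokenPairs hw' (by rw [ha']; exact hp)])
    rfl
  · rintro ⟨w, hw⟩
    obtain ⟨a, ha, ha'⟩ := exists_extends_of_hasType hk hp hw
    exact ⟨⟨⟨a, ha⟩, ⟨w, ha'⟩⟩, rfl⟩

open PartialBij in
theorem card_brokenPairs {w : Perm (Pt n)} {k : ℕ} (hk : k ≤ n) {p : k.Partition}
    (hp : IsProper p) (hw : HasType (twist w) p.parts) : (brokenPairs w).card = k := by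
  obtain ⟨a, ha, ha'⟩ := exists_extends_of_hasType hk hp hw
  rw [← dom_eq_brokenPairs ha' (by rw [ha]; exact hp), ← cosetType_sum, ha, p.parts_sum]

/-- Outside the preimage under `w₂` of the joint set both factors preserve pairs, and the
corestriction of `w₂` shows that this preimage has the size of the joint set. -/
theorem card_brokenPairs_mul_le (w₁ w₂ : Perm (Pt n)) :
    (brokenPairs (w₁ * w₂)).card ≤ (brokenPairs w₁ ∪ brokenPairs w₂⁻¹).card := by
  obtain ⟨c, hc, hc'⟩ := PartialBij.exists_corestrict w₂ (brokenPairs w₁ ∪ brokenPairs w₂⁻¹)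
    fun x hx => by
      by_contra hx'
      exact hx (Finset.mem_union_right _ (mem_brokenPairs.2 hx'))
  rw [← hc, c.card_cod]
  refine Finset.card_le_card fun i hi => ?_
  by_contra hi'
  rw [mem_brokenPairs (x := (i, false))] at hi
  refine hi (PreservesPair.mul ?_ (hc'.2 _ hi'))
  by_contra hb
  have h1 : (w₂ (i, false)).1 ∈ c.cod := hc ▸ Finset.mem_union_left _ (mem_brokenPairs.2 hb)
  exact hi' ((PartialBij.mem_cod_iff hc'.1 _).1 h1)

/-- The total coefficient of a coset-type in the product of `K n lam` and `K n del`. -/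
theorem card_mul_coeff_K {l d : ℕ} {lam : l.Partition} {del : d.Partition}
    {p : (l + d).Partition} (hlam : IsProper lam) (hdel : IsProper del) (hp : IsProper p)
    (hn : l + d ≤ n) {c : ℂ}
    (hc : ∀ w : Perm (Pt n), HasType (twist w) p.parts → (K n lam * K n del).coeff w = c) :
    (Nat.card {w : Perm (Pt n) // HasType (twist w) p.parts} : ℂ) * c =
      (n.choose (l + d) * pairCount (l + d) lam.parts del.parts p.parts *
        (2 ^ n * n.factorial * (2 ^ n * n.factorial)) : ℕ) := by
  classical
  have hl : l ≤ n := by omega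
  have hd : d ≤ n := by omega
  have h1 : (Nat.card {w : Perm (Pt n) // HasType (twist w) p.parts} : ℂ) * c =
      ∑ w : {w : Perm (Pt n) // HasType (twist w) p.parts},
        (Nat.card {q : Perm (Pt n) × Perm (Pt n) // HasType (twist q.1) lam.parts ∧
          HasType (twist q.2) del.parts ∧ q.1 * q.2 = w.1} : ℂ) := by
    rw [Nat.card_eq_fintype_card, ← nsmul_eq_mul, ← Finset.card_univ, ← Finset.sum_const]
    refine Finset.sum_congr rfl fun w _ => ?_
    rw [← hc w.1 w.2, coeff_K_mul_K hl hd]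
  rw [h1, ← Nat.cast_sum, ← Nat.card_sigma, ← card_pairs_hasType]
  congr 1
  refine Nat.card_eq_of_bijective (fun s => ⟨s.2.1, s.2.2.1, s.2.2.2.1, ?_, ?_⟩) ⟨?_, ?_⟩
  · rw [s.2.2.2.2]
    exact s.1.2
  -- The joint set of broken pairs has at least `l + d` elements because of the product and at most
  -- `l + d` because of the factors. The maximality of the degree of `p` is used here.
  · obtain ⟨⟨w, hw⟩, ⟨w₁, w₂⟩, h₁, h₂, h₃⟩ := s
    obtain rfl : w₁ * w₂ = w := h₃
    have h3 := card_brokenPairs_mul_le w₁ w₂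
    have h4 := Finset.card_union_le (brokenPairs w₁) (brokenPairs w₂⁻¹)
    rw [card_brokenPairs hl hlam h₁,
      card_brokenPairs hd hdel ((hasType_twist_inv _ _).2 h₂)] at h4
    rw [card_brokenPairs hn hp hw] at h3
    exact le_antisymm h4 h3
  · rintro ⟨⟨w, hw⟩, q, h₁, h₂, h₃⟩ ⟨⟨w', hw'⟩, q', h₁', h₂', h₃'⟩ h
    obtain rfl : q.1 * q.2 = w := h₃
    obtain rfl : q'.1 * q'.2 = w' := h₃'
    obtain rfl : q = q' := congrArg Subtype.val h
    rfl
  · rintro ⟨q, h₁, h₂, h₃, -⟩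
    exact ⟨⟨⟨q.1 * q.2, h₃⟩, ⟨q, h₁, h₂, rfl⟩⟩, rfl⟩

end Hecke

/-! ### The coefficients as multiples of `ratio` -/

section Coefficients

variable {n l d : ℕ} {lam : l.Partition} {del : d.Partition}

/-- The ratio of counts of matchings of `[2k]` that determines all structure coefficients. -/
noncomputable def ratio {l d k : ℕ} (lam : l.Partition) (del : d.Partition) (p : k.Partition) :
    ℂ :=
  pairCount k lam.parts del.parts p.parts / singleCount k p.parts

theorem singleCount_ne_zero {k : ℕ} (p : k.Partition) : (singleCount k p.parts : ℂ) ≠ 0 :=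
  Nat.cast_ne_zero.2 (singleCount_pos p).ne'

theorem pairCount_eq_ratio {k : ℕ} (lam : l.Partition) (del : d.Partition) (p : k.Partition) :
    (pairCount k lam.parts del.parts p.parts : ℂ) =
      ratio lam del p * singleCount k p.parts := by
  rw [ratio, div_mul_cancel₀ _ (singleCount_ne_zero p)]

theorem exists_cosetType_eq {k : ℕ} (hk : k ≤ n) (p : k.Partition) :
    ∃ a : PartialBij n, cosetType a.map = p.parts := by
  have h1 := card_extends_hasType n p
  have h2 : 0 < n.choose k * singleCount k p.parts * (2 ^ n * n.factorial) :=
    Nat.mul_pos (Nat.mul_pos (Nat.choose_pos hk) (singleCount_pos p)) (by positivity)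
  rw [← h1] at h2
  obtain ⟨⟨a, ha⟩⟩ := (Nat.card_pos_iff.1 (Nat.pos_of_mul_pos_right h2)).1
  exact ⟨a, ha⟩

/-- The quotient of `card_mul_coeff` by `card_extends_hasType`: the binomial and one factor `2 ^ n *
n!` cancel, and `extCount n k` survives from the number of extensions of each `a`. -/
theorem mul_S_apply_eq (hlam : IsProper lam) (hdel : IsProper del) (hl : l ≤ n) (hd : d ≤ n)
    {k : ℕ} {p : k.Partition} {a : PartialBij n} (ha : cosetType a.map = p.parts) :
    D.mul (S n lam) (S n del) a =
      2 ^ n * n.factorial * extCount n k / (extCount n l * extCount n d) * ratio lam del p := by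
  have hk : k ≤ n := by
    rw [← p.parts_sum, ← ha, PartialBij.cosetType_sum]
    exact (Finset.card_le_univ _).trans_eq (Fintype.card_fin n)
  have h1 := card_mul_coeff (p := p) hlam hdel hl hd fun a' ha' =>
    mul_S_congr hlam hdel hl hd (ha'.trans ha.symm)
  have h2 : (Nat.card {a : PartialBij n // cosetType a.map = p.parts} : ℂ) * extCount n k =
      n.choose k * singleCount k p.parts * (2 ^ n * n.factorial) := by
    exact_mod_cast card_extends_hasType n p
  push_cast at h1
  rw [pairCount_eq_ratio] at h1
  have hg : ∀ j, (extCount n j : ℂ) ≠ 0 := fun j => Nat.cast_ne_zero.2 (extCount_pos n j).ne'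
  have hB : (2 ^ n * n.factorial : ℂ) ≠ 0 := by
    exact_mod_cast (by positivity : 0 < 2 ^ n * n.factorial).ne'
  have hC : (n.choose k : ℂ) ≠ 0 := Nat.cast_ne_zero.2 (Nat.choose_pos hk).ne'
  have hA : (Nat.card {a : PartialBij n // cosetType a.map = p.parts} : ℂ) ≠ 0 := by
    intro h0
    rw [h0, zero_mul] at h2
    exact mul_ne_zero (mul_ne_zero hC (singleCount_ne_zero p)) hB h2.symm
  apply mul_left_cancel₀ hA
  apply mul_left_cancel₀ (mul_ne_zero (hg l) (hg d))
  have hl' := hg l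
  have hd' := hg d
  rw [mul_left_comm, h1]
  field_simp
  linear_combination (-(ratio lam del p)) * (n.factorial : ℂ) * h2

theorem coeff_eq_of_isHeckeExpansion {rho : (l + d).Partition} (hlam : IsProper lam)
    (hdel : IsProper del) (hrho : IsProper rho) (hn : l + d ≤ n)
    {a : (k : ℕ) → k.Partition → ℂ} (ha : IsHeckeExpansion n lam del a) :
    a (l + d) rho = 2 ^ n * n.factorial * ratio lam del rho := by
  have h1 := card_mul_coeff_K (n := n) hlam hdel hrho hn fun w hw =>
    (eq_sum_K_iff _ _).1 ha w _ rho hn hrho hw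
  have hB : (2 ^ n * n.factorial : ℂ) ≠ 0 := by
    exact_mod_cast (by positivity : 0 < 2 ^ n * n.factorial).ne'
  have hC : (n.choose (l + d) : ℂ) ≠ 0 := Nat.cast_ne_zero.2 (Nat.choose_pos hn).ne'
  rw [card_hasType hn hrho] at h1
  push_cast at h1
  rw [pairCount_eq_ratio] at h1
  apply mul_left_cancel₀ (mul_ne_zero (mul_ne_zero hC (singleCount_ne_zero rho)) hB)
  rw [h1]
  ring

/-- The coefficients of the expansion of the product of two sequences `T`. -/
noncomputable def universalCoeff (lam : l.Partition) (del : d.Partition) (k : ℕ)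
    (p : k.Partition) : ℂ :=
  2 ^ (l + d) / 2 ^ k * (l.factorial * d.factorial / k.factorial) * ratio lam del p

theorem D.mul_smul_smul (r s : ℂ) (x y : D n) :
    D.mul (r • x) (s • y) = (r * s) • D.mul x y := by
  rw [D.mul, D.mul, Finsupp.sum_fintype _ _ (by simp), Finsupp.sum_fintype _ _ (by simp),
    Finset.smul_sum]
  refine Finset.sum_congr rfl fun a _ => ?_
  rw [Finsupp.sum_fintype _ _ (by simp), Finsupp.sum_fintype _ _ (by simp), Finset.smul_sum]
  refine Finset.sum_congr rfl fun b _ => ?_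
  rw [smul_smul, Finsupp.smul_apply, Finsupp.smul_apply, smul_eq_mul, smul_eq_mul]
  congr 1
  ring

theorem sum_T_eq (b : (k : ℕ) → k.Partition → ℂ) :
    ∑ k ∈ Finset.range (n + 1), ∑ p : k.Partition, b k p • T p n =
      ∑ k ∈ Finset.range (n + 1), ∑ p : k.Partition, (b k p * (n.choose k : ℂ)⁻¹) • S n p := by
  refine Finset.sum_congr rfl fun k hk => Finset.sum_congr rfl fun p _ => ?_
  rw [T, if_pos (Nat.le_of_lt_succ (Finset.mem_range.1 hk)), smul_smul]

/-- The binomials in `T` are the normalisation for which, apart from `(n.choose k)⁻¹`, all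
dependence on `n` cancels. The coefficient is therefore the same in every degree. -/
theorem mul_T_apply (hlam : IsProper lam) (hdel : IsProper del) (hl : l ≤ n) (hd : d ≤ n)
    {k : ℕ} {p : k.Partition} {a : PartialBij n} (ha : cosetType a.map = p.parts) :
    D.mul (T lam n) (T del n) a = universalCoeff lam del k p * (n.choose k : ℂ)⁻¹ := by
  have hk : k ≤ n := by
    rw [← p.parts_sum, ← ha, PartialBij.cosetType_sum]
    exact (Finset.card_le_univ _).trans_eq (Fintype.card_fin n)
  rw [T, T, if_pos hl, if_pos hd, D.mul_smul_smul, Finsupp.smul_apply,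
    mul_S_apply_eq hlam hdel hl hd ha, universalCoeff, smul_eq_mul, Nat.cast_choose ℂ hl,
    Nat.cast_choose ℂ hd, Nat.cast_choose ℂ hk]
  have hf : ∀ j : ℕ, (j.factorial : ℂ) ≠ 0 := fun j => Nat.cast_ne_zero.2 j.factorial_ne_zero
  have h2 : ∀ j ≤ n, (extCount n j : ℂ) = 2 ^ n / 2 ^ j * (n - j).factorial := fun j hj => by
    rw [extCount]
    push_cast
    rw [pow_sub₀ _ two_ne_zero hj, div_eq_mul_inv]
  rw [h2 l hl, h2 d hd, h2 k hk, pow_add]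
  have e1 := hf n
  have e2 := hf l
  have e3 := hf d
  have e4 := hf k
  have e5 := hf (n - l)
  have e6 := hf (n - d)
  have e7 := hf (n - k)
  field_simp

/-- A proper type of size `j` moves `j` pairs and does not fit on fewer. It follows that the
universal expansion also holds for small `n`, where a factor `T` is `0`. -/
theorem pairCount_eq_zero (hlam : IsProper lam) (hdel : IsProper del) {k : ℕ}
    (hk : ¬ (l ≤ k ∧ d ≤ k)) (r : Multiset ℕ) :
    pairCount k lam.parts del.parts r = 0 := by
  have key : ∀ {j : ℕ} {q : j.Partition}, IsProper q → ∀ {v : Perm (Pt k)},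
      IsMatchingPair (swap k) v → HasType v q.parts → j ≤ k := by
    intro j q hq v hv hvq
    obtain ⟨w, rfl⟩ := exists_twist_eq hv
    obtain ⟨k', hk', p', hp', hw⟩ := exists_proper_partition w
    rwa [← q.parts_sum, parts_eq_of_hasType hq hp' hvq hw, p'.parts_sum]
  rw [pairCount, Nat.card_eq_zero]
  exact Or.inl ⟨fun v => hk ⟨key hlam v.2.1.1 v.2.1.2, key hdel v.2.2.1.1 v.2.2.1.2⟩⟩

theorem isUniversalExpansion_universalCoeff (hlam : IsProper lam) (hdel : IsProper del) :
    IsUniversalExpansion lam del (universalCoeff lam del) := by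
  intro n _
  by_cases h : l ≤ n ∧ d ≤ n
  · rw [sum_T_eq, eq_sum_S_iff]
    intro a k p ha
    exact mul_T_apply hlam hdel h.1 h.2 ha
  · have h1 : D.mul (T lam n) (T del n) = 0 := by
      rcases not_and_or.1 h with h | h
      · rw [T, if_neg h, D.mul, Finsupp.sum_zero_index]
      · rw [D.mul, Finsupp.sum_fintype _ _ (by simp)]
        refine Finset.sum_eq_zero fun a _ => ?_
        rw [T, if_neg h, Finsupp.sum_zero_index]
    rw [h1]
    refine (Finset.sum_eq_zero fun k hk => Finset.sum_eq_zero fun p _ => ?_).symm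
    have hk' := Nat.le_of_lt_succ (Finset.mem_range.1 hk)
    rw [universalCoeff, ratio, pairCount_eq_zero hlam hdel fun h' =>
      h ⟨h'.1.trans hk', h'.2.trans hk'⟩]
    simp

theorem eq_universalCoeff (hlam : IsProper lam) (hdel : IsProper del)
    {b : (k : ℕ) → k.Partition → ℂ} (hb : IsUniversalExpansion lam del b) :
    b = universalCoeff lam del := by
  funext k p
  -- A degree in which `p`, `lam` and `del` all fit; the `1` ensures `n ≥ 1`.
  let n := k + l + d + 1
  have hk : k ≤ n := by omega
  obtain ⟨a, ha⟩ := exists_cosetType_eq hk p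
  have h1 := hb n (by omega)
  rw [sum_T_eq, eq_sum_S_iff] at h1
  have h2 := h1 a k p ha
  rw [mul_T_apply hlam hdel (by omega) (by omega) ha] at h2
  have hC : ((n.choose k : ℂ)⁻¹) ≠ 0 :=
    inv_ne_zero (Nat.cast_ne_zero.2 (Nat.choose_pos hk).ne')
  exact (mul_right_cancel₀ hC h2).symm

theorem exists_isPartialBijExpansion (hlam : IsProper lam) (hdel : IsProper del) (hl : l ≤ n)
    (hd : d ≤ n) : ∃ c, IsPartialBijExpansion n lam del c :=
  exists_eq_sum_S _ fun _ _ h => mul_S_congr hlam hdel hl hd h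

theorem coeff_eq_of_isPartialBijExpansion {rho : (l + d).Partition} (hlam : IsProper lam)
    (hdel : IsProper del) {c : (k : ℕ) → k.Partition → ℂ}
    (hc : IsPartialBijExpansion (l + d) lam del c) :
    c (l + d) rho = ((l + d).factorial : ℂ) / (l.factorial * d.factorial) *
      ratio lam del rho := by
  obtain ⟨a, ha⟩ := exists_cosetType_eq le_rfl rho
  rw [← (eq_sum_S_iff _ _).1 hc a _ rho ha,
    mul_S_apply_eq hlam hdel (Nat.le_add_right l d) (Nat.le_add_left d l) ha]
  have hf : ∀ j : ℕ, (j.factorial : ℂ) ≠ 0 := fun j => Nat.cast_ne_zero.2 j.factorial_ne_zero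
  have e2 := hf l
  have e3 := hf d
  simp only [extCount, Nat.sub_self, Nat.add_sub_cancel_left, Nat.add_sub_cancel, pow_zero,
    Nat.factorial_zero, mul_one, Nat.cast_one, Nat.cast_mul, Nat.cast_pow, Nat.cast_ofNat, pow_add]
  field_simp

end Coefficients
end HeckeS2n

theorem mainTheorem8 {l d r : ℕ} (lam : l.Partition) (del : d.Partition) (rho : r.Partition)
    (hlam : HeckeS2n.IsProper lam) (hdel : HeckeS2n.IsProper del) (hrho : HeckeS2n.IsProper rho)
    (hr : r = l + d) :
    -- the coefficients in question exist
    (∃! b, HeckeS2n.IsUniversalExpansion lam del b) ∧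
    (∃ c, HeckeS2n.IsPartialBijExpansion r lam del c) ∧
    (∀ n, r ≤ n → ∃ a, HeckeS2n.IsHeckeExpansion n lam del a) ∧
    ∀ b, HeckeS2n.IsUniversalExpansion lam del b →
      -- the formula in terms of `b`
      (∀ n, r ≤ n → ∀ a, HeckeS2n.IsHeckeExpansion n lam del a →
        a r rho = b r rho * ((r.factorial : ℂ) / ((l.factorial : ℂ) * (d.factorial : ℂ))) *
          (2 ^ n * (n.factorial : ℂ))) ∧
      -- the formula in terms of `c(|ρ|)`
      (∀ c, HeckeS2n.IsPartialBijExpansion r lam del c →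
        ∀ n, r ≤ n → ∀ a, HeckeS2n.IsHeckeExpansion n lam del a →
          a r rho = c r rho *
            ((l.factorial : ℂ) * (d.factorial : ℂ) / ((l + d).factorial : ℂ)) *
            (2 ^ n * (n.factorial : ℂ))) ∧
      -- the polynomial is constant
      (∀ f : Polynomial ℂ,
        (∀ n, r ≤ n → ∀ a, HeckeS2n.IsHeckeExpansion n lam del a →
          a r rho = 2 ^ n * (n.factorial : ℂ) * f.eval (n : ℂ)) ↔
        f = Polynomial.C
          (b r rho * ((r.factorial : ℂ) / ((l.factorial : ℂ) * (d.factorial : ℂ))))) := by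
  subst hr
  have hf : ∀ j : ℕ, (j.factorial : ℂ) ≠ 0 := fun j => Nat.cast_ne_zero.2 j.factorial_ne_zero
  have e1 := hf (l + d)
  have e2 := hf l
  have e3 := hf d
  have hHecke : ∀ n, l + d ≤ n → ∃ a, HeckeS2n.IsHeckeExpansion n lam del a := fun n hn =>
    HeckeS2n.exists_heckeExpansion (by omega) (by omega) lam del
  refine ⟨⟨_, HeckeS2n.isUniversalExpansion_universalCoeff hlam hdel,
      fun b hb => HeckeS2n.eq_universalCoeff hlam hdel hb⟩,
    HeckeS2n.exists_isPartialBijExpansion hlam hdel (by omega) (by omega), hHecke,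
    fun b hb => ?_⟩
  obtain rfl := HeckeS2n.eq_universalCoeff hlam hdel hb
  -- In top degree `k = l + d` the powers of `2` cancel.
  have hconst : HeckeS2n.universalCoeff lam del (l + d) rho *
      (((l + d).factorial : ℂ) / ((l.factorial : ℂ) * (d.factorial : ℂ))) =
        HeckeS2n.ratio lam del rho := by
    rw [HeckeS2n.universalCoeff]
    field_simp
  rw [hconst]
  have key : ∀ n, l + d ≤ n → ∀ a, HeckeS2n.IsHeckeExpansion n lam del a →
      a (l + d) rho = 2 ^ n * (n.factorial : ℂ) * HeckeS2n.ratio lam del rho := fun n hn a ha =>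
    HeckeS2n.coeff_eq_of_isHeckeExpansion hlam hdel hrho hn ha
  refine ⟨fun n hn a ha => ?_, fun c hc n hn a ha => ?_, fun f => ⟨fun h => ?_, ?_⟩⟩
  · rw [key n hn a ha]
    ring
  · rw [key n hn a ha, HeckeS2n.coeff_eq_of_isPartialBijExpansion hlam hdel hc]
    field_simp
  -- The polynomial agrees with the constant at every integer from `l + d` on, hence everywhere;
  -- existence of the Hecke expansions is needed to make the hypothesis on `f` effective.
  · refine Polynomial.eq_of_infinite_eval_eq _ _ (Set.infinite_of_injective_forall_mem
      (f := fun m : ℕ => ((l + d + m : ℕ) : ℂ))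
      (fun m m' hm => Nat.add_left_cancel (Nat.cast_injective hm)) fun m => ?_)
    obtain ⟨a, ha⟩ := hHecke (l + d + m) (Nat.le_add_right _ _)
    have h1 := h _ (Nat.le_add_right _ _) a ha
    rw [key _ (Nat.le_add_right _ _) a ha] at h1
    have hB : (2 ^ (l + d + m) * (l + d + m).factorial : ℂ) ≠ 0 :=
      mul_ne_zero (pow_ne_zero _ two_ne_zero) (hf _)
    have h2 := mul_left_cancel₀ hB h1
    simpa using h2.symm
  · rintro rfl n hn a ha
    rw [key n hn a ha, Polynomial.eval_C]
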